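/- Let $(X_k)_{k\ge 1}$ be independent identically distributed real random variables with $E[X_k]=0$ and $E[X_k^2]=1$. Let $\mathcal N$ be the standard normal law and let $d_W(Y,\mathcal N)=\sup_h |E[h(Y)]-\int h\,d\mathcal N|$, the supremum being over all $h:\mathbb R\to\mathbb R$ that are Lipschitz with constant at most $1$. Let $n\ge 2$, let $A=(a_{k,l})_{1\le k,l\le n}$ be a real symmetric matrix with vanishing diagonal, and put $Q_n=\sum_{1\le k,l\le n}a_{k,l}X_kX_l$. Assume that $E[Q_n^2]=1$ (one has $E[Q_n]=0$ automatically). Then, the right-hand sides being $+\infty$ when $E[X_1^4]=\infty$, $$d_W(Q_n,\mathcal N)\le 2\sqrt{E[X_1^4]\sum_{l=1}^n\Big(\sum_{k=1}^n a_{k,l}^2\Big)^2+2\sum_{1\le l,p\le n}\Big(\sum_{k=1}^n a_{k,l}a_{k,p}\Big)^2}+4\sqrt{\big(3E[X_1^4]+(E[X_1^4])^2\big)\sum_{k=1}^n\Big(\sum_{l=1}^n a_{k,l}^2\Big)^2}.$$ Consequently, with $L_n^2:=\max_{1\le k\le n}\sum_{l=1}^n a_{k,l}^2$ (which is positive, and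 $L_n^4:=(L_n^2)^2$), $$d_W(Q_n,\mathcal N)\le 2\sqrt n\,L_n^2\left(\sqrt{E[X_1^4]+\frac{2}{nL_n^4}\sum_{1\le l,p\le n}\Big(\sum_{k=1}^n a_{k,l}a_{k,p}\Big)^2}+2\sqrt{3E[X_1^4]+(E[X_1^4])^2}\right).$$ In particular, the rate $1/\sqrt n$ is attained in the following example: for every $n\ge 1$, $$d_W\Big(\frac1{\sqrt n}\sum_{k=1}^n X_{2k-1}X_{2k},\ \mathcal N\Big)\le\frac{8\,E[X_1^4]}{\sqrt n}.$$ -/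

import Mathlib

open MeasureTheory ProbabilityTheory
open scoped ENNReal

noncomputable section

/-- The Wasserstein distance `sup_{h ∈ Lip(1)} |∫ h dμ - ∫ h dν|` between two laws on the real line
with finite first moment (so that every Lipschitz `h` is integrable). It takes its values in
`[0, ∞]`, so that the supremum is always a genuine one. -/
def wassersteinDist (μ ν : Measure ℝ) : ℝ≥0∞ :=
  ⨆ (h : ℝ → ℝ) (_ : LipschitzWith 1 h), ENNReal.ofReal |∫ x, h x ∂μ - ∫ x, h x ∂ν|

/-- The quadratic form `∑_{k,l} a_{k,l} X_k X_l` in the first `n` variables of the sequence `X`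
(numbered from `0`). -/
def quadForm {Ω : Type*} {n : ℕ} (A : Matrix (Fin n) (Fin n) ℝ) (X : ℕ → Ω → ℝ) (ω : Ω) : ℝ :=
  ∑ k : Fin n, ∑ l : Fin n, A k l * X k ω * X l ω

/-- The quantity `L_n² = max_k ∑_l a_{k,l}²`. -/
def maxRowSq {n : ℕ} (A : Matrix (Fin n) (Fin n) ℝ) : ℝ :=
  ⨆ k : Fin n, ∑ l : Fin n, A k l ^ 2

/-- The fourth moment `E[Y⁴]`, with value in `[0, ∞]`. -/
def fourthMoment {Ω : Type*} [MeasurableSpace Ω] (P : Measure Ω) (Y : Ω → ℝ) : ℝ≥0∞ :=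
  ∫⁻ ω, ENNReal.ofReal (Y ω ^ 4) ∂P

end

/-! The bound is Stein's method. For `h` Lipschitz with constant `1` (first smoothed by a moving
average) the Stein equation `f' x - x f x = h x - ∫ h dγ`, `γ` the standard normal law, has a
solution with `|f'| ≤ 1` and `f'` Lipschitz with constant `2`, so `E[f'(Q) - Q f(Q)]` has to be
bounded for such `f`. With `V_k = ∑ l, a_{k,l} X_l` one has `Q = ∑ k, X_k V_k` and
`f'(Q) - Q f(Q) = (1 - 2 ∑ k, V_k²) f'(Q) - ∑ k, (X_k V_k f(Q) - 2 V_k² f'(Q))`.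

The first term is at most the standard deviation of the quadratic form `2 ∑ k, V_k²`. In the
`k`-th summand of the second, `Q = W + 2 X_k V_k`, where the pair `(W, V_k)` is independent of
`X_k`. Conditionally on that pair it is half an expression `E[Z g(Z) - g'(Z)]` with `g'` Lipschitz,
and for `Z` centred with unit variance this is at most `(2/3) Lip(g') E|Z|³`. Hölder's inequality
and the fourth moments of the linear forms `V_k` give the constants. -/

section GaussianTail

open Set Filter Topology

/-- The density of the standard normal law. -/
noncomputable abbrev stdPDF : ℝ → ℝ := gaussianPDFReal 0 1

/-- The upper tail of the standard normal law. -/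
noncomputable def stdTail (w : ℝ) : ℝ := ∫ t in Ioi w, stdPDF t

/-- The mean excess `E[(Z - w)⁺]` of a standard normal variable `Z`, in closed form. -/
noncomputable def stdExcess (w : ℝ) : ℝ := stdPDF w - w * stdTail w

theorem stdPDF_eq (x : ℝ) : stdPDF x = (√(2 * Real.pi))⁻¹ * Real.exp (-x ^ 2 / 2) := by
  simp [gaussianPDFReal_def]

theorem stdPDF_pos (x : ℝ) : 0 < stdPDF x := gaussianPDFReal_pos 0 1 x one_ne_zero

theorem stdPDF_neg (x : ℝ) : stdPDF (-x) = stdPDF x := by simp [stdPDF_eq]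

theorem stdPDF_le_half (x : ℝ) : stdPDF x ≤ 1 / 2 := by
  have h_sqrt : (2 : ℝ) ≤ √(2 * Real.pi) :=
    Real.le_sqrt_of_sq_le (by nlinarith [Real.pi_gt_three])
  have h_exp : Real.exp (-x ^ 2 / 2) ≤ 1 := Real.exp_le_one_iff.2 (by nlinarith [sq_nonneg x])
  calc stdPDF x = (√(2 * Real.pi))⁻¹ * Real.exp (-x ^ 2 / 2) := stdPDF_eq x
    _ ≤ 2⁻¹ * 1 := by gcongr
    _ = 1 / 2 := by norm_num

theorem integrable_stdPDF : Integrable stdPDF := integrable_gaussianPDFReal 0 1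

theorem hasDerivAt_stdPDF (x : ℝ) : HasDerivAt stdPDF (-x * stdPDF x) x := by
  have h : HasDerivAt (fun x : ℝ => -x ^ 2 / 2) (-x) x := by
    convert! (hasDerivAt_pow 2 x).neg.div_const 2 using 1
    simp only [Nat.cast_ofNat, Nat.add_one_sub_one, pow_one]
    ring
  rw [funext stdPDF_eq]
  convert! h.exp.const_mul (√(2 * Real.pi))⁻¹ using 1
  ring

theorem continuous_stdPDF : Continuous stdPDF :=
  continuous_iff_continuousAt.2 fun x => (hasDerivAt_stdPDF x).continuousAt

theorem tendsto_pow_mul_stdPDF (k : ℕ) : Tendsto (fun x => x ^ k * stdPDF x) atTop (𝓝 0) := by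
  have h := ((tendsto_rpow_abs_mul_exp_neg_mul_sq_cocompact (a := 1 / 2) (by norm_num) k).mono_left
    atTop_le_cocompact).const_mul (√(2 * Real.pi))⁻¹
  rw [mul_zero] at h
  refine h.congr' ?_
  filter_upwards [eventually_ge_atTop 0] with x hx
  rw [abs_of_nonneg hx, Real.rpow_natCast, stdPDF_eq]
  ring_nf

theorem hasDerivAt_integral_Ioi {E : Type*} [NormedAddCommGroup E] [NormedSpace ℝ E]
    [CompleteSpace E] {g : ℝ → E} (hc : Continuous g) (hg : ∀ a, IntegrableOn g (Ioi a)) (w : ℝ) :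
    HasDerivAt (fun w => ∫ t in Ioi w, g t) (-g w) w := by
  have h_split : (fun w => ∫ t in Ioi w, g t)
      = fun w => (∫ t in Ioi 0, g t) - ∫ t in (0 : ℝ)..w, g t := by
    funext w
    rw [← intervalIntegral.integral_interval_add_Ioi (hg 0) (hg w), add_sub_cancel_left]
  rw [h_split]
  exact (intervalIntegral.integral_hasDerivAt_right (hc.intervalIntegrable 0 w)
    hc.stronglyMeasurable.stronglyMeasurableAtFilter hc.continuousAt).const_sub (∫ t in Ioi 0, g t)

theorem hasDerivAt_stdTail (w : ℝ) : HasDerivAt stdTail (-stdPDF w) w :=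
  hasDerivAt_integral_Ioi continuous_stdPDF (fun _ => integrable_stdPDF.integrableOn) w

theorem continuous_stdTail : Continuous stdTail :=
  continuous_iff_continuousAt.2 fun x => (hasDerivAt_stdTail x).continuousAt

theorem stdTail_nonneg (w : ℝ) : 0 ≤ stdTail w :=
  setIntegral_nonneg measurableSet_Ioi fun x _ => (stdPDF_pos x).le

theorem stdTail_add_stdTail_neg (w : ℝ) : stdTail w + stdTail (-w) = 1 := by
  have h_reflect : stdTail (-w) = ∫ t in Iic w, stdPDF t := by
    simpa only [stdTail, stdPDF_neg, neg_neg] using integral_comp_neg_Ioi (-w) stdPDF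
  have h_split := integral_add_compl (s := Iic w) measurableSet_Iic integrable_stdPDF
  rw [compl_Iic, integral_gaussianPDFReal_eq_one 0 one_ne_zero] at h_split
  rw [h_reflect, ← h_split, stdTail, add_comm]

theorem mul_stdTail_le (w : ℝ) : w * stdTail w ≤ stdPDF w := by
  rcases le_or_gt w 0 with hw | hw
  · exact (mul_nonpos_of_nonpos_of_nonneg hw (stdTail_nonneg w)).trans (stdPDF_pos w).le
  have hd : ∀ x ∈ Ici w, HasDerivAt stdPDF (-x * stdPDF x) x := fun x _ => hasDerivAt_stdPDF x
  have h_nonpos : ∀ x ∈ Ioi w, -x * stdPDF x ≤ 0 := fun x hx =>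
    mul_nonpos_of_nonpos_of_nonneg (neg_nonpos.2 (hw.trans hx).le) (stdPDF_pos x).le
  have h_lim : Tendsto stdPDF atTop (𝓝 0) := by simpa using tendsto_pow_mul_stdPDF 0
  have h_int := integrableOn_Ioi_deriv_of_nonpos' hd h_nonpos h_lim
  have h_ftc := integral_Ioi_of_hasDerivAt_of_nonpos' hd h_nonpos h_lim
  calc w * stdTail w = ∫ t in Ioi w, w * stdPDF t := (integral_const_mul _ _).symm
    _ ≤ ∫ t in Ioi w, -(-t * stdPDF t) := by
      refine setIntegral_mono_on (integrable_stdPDF.integrableOn.const_mul w) h_int.neg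
        measurableSet_Ioi fun x hx => ?_
      rw [neg_mul, neg_neg]
      exact mul_le_mul_of_nonneg_right (mem_Ioi.1 hx).le (stdPDF_pos x).le
    _ = stdPDF w := by rw [integral_neg, h_ftc]; ring

theorem tendsto_pow_mul_stdTail (k : ℕ) : Tendsto (fun x => x ^ k * stdTail x) atTop (𝓝 0) := by
  refine squeeze_zero' ?_ ?_ (tendsto_pow_mul_stdPDF k)
  · filter_upwards [eventually_ge_atTop 0] with x hx
    exact mul_nonneg (pow_nonneg hx k) (stdTail_nonneg x)
  · filter_upwards [eventually_ge_atTop 1] with x hx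
    gcongr
    exact (le_mul_of_one_le_left (stdTail_nonneg x) hx).trans (mul_stdTail_le x)

theorem stdExcess_nonneg (w : ℝ) : 0 ≤ stdExcess w := sub_nonneg.2 (mul_stdTail_le w)

theorem hasDerivAt_stdExcess (w : ℝ) : HasDerivAt stdExcess (-stdTail w) w := by
  convert! (hasDerivAt_stdPDF w).sub ((hasDerivAt_id w).mul (hasDerivAt_stdTail w)) using 1
  simp

theorem tendsto_stdExcess : Tendsto stdExcess atTop (𝓝 0) := by
  simpa [stdExcess] using! (tendsto_pow_mul_stdPDF 0).sub (tendsto_pow_mul_stdTail 1)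

theorem stdExcess_neg (w : ℝ) : stdExcess (-w) = stdExcess w + w := by
  simp only [stdExcess, stdPDF_neg]
  linear_combination w * stdTail_add_stdTail_neg w

theorem nonneg_of_hasDerivAt_nonpos_of_tendsto_zero {f f' : ℝ → ℝ}
    (hf : ∀ x, HasDerivAt f (f' x) x) (hf' : ∀ x, f' x ≤ 0) (h_lim : Tendsto f atTop (𝓝 0))
    (x : ℝ) : 0 ≤ f x :=
  (antitone_of_hasDerivAt_nonpos hf hf').le_of_tendsto h_lim x

theorem mul_stdPDF_le (w : ℝ) : w * stdPDF w ≤ (1 + w ^ 2) * stdTail w := by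
  refine sub_nonneg.1 (nonneg_of_hasDerivAt_nonpos_of_tendsto_zero
    (f := fun w => (1 + w ^ 2) * stdTail w - w * stdPDF w) (f' := fun w => -2 * stdExcess w)
    (fun w => ?_) (fun w => by linarith [stdExcess_nonneg w]) ?_ w)
  · convert! (((hasDerivAt_pow 2 w).const_add 1).mul (hasDerivAt_stdTail w)).sub
      ((hasDerivAt_id w).mul (hasDerivAt_stdPDF w)) using 1
    simp only [stdExcess, id_eq, Nat.cast_ofNat, Nat.add_one_sub_one, pow_one]
    ring
  · have h := ((tendsto_pow_mul_stdTail 0).add (tendsto_pow_mul_stdTail 2)).sub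
      (tendsto_pow_mul_stdPDF 1)
    simp only [add_zero, sub_zero] at h
    exact h.congr fun x => by ring

-- The derivative of the difference of the two sides is
-- `-(T - p)² - p (p - 2 w p + 2 w² T)` with `p` the density and `T` the tail, and the Mills bound
-- `mul_stdPDF_le` gives `(1 + w²) (p - 2 w p + 2 w² T) ≥ p (1 - w)²`.
theorem mul_sq_stdTail_add_le (w : ℝ) :
    w * stdTail w ^ 2 + 2 * stdPDF w ^ 2 ≤ 2 * (1 + w) * stdPDF w * stdTail w := by
  refine sub_nonneg.1 (nonneg_of_hasDerivAt_nonpos_of_tendsto_zero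
    (f := fun w => 2 * (1 + w) * stdPDF w * stdTail w
      - (w * stdTail w ^ 2 + 2 * stdPDF w ^ 2))
    (f' := fun w => -((stdTail w - stdPDF w) ^ 2
      + stdPDF w * (stdPDF w - 2 * w * stdPDF w + 2 * w ^ 2 * stdTail w)))
    (fun w => ?_) (fun w => ?_) ?_ w)
  · convert! ((((hasDerivAt_id w).const_add 1).const_mul 2).mul (hasDerivAt_stdPDF w)
      |>.mul (hasDerivAt_stdTail w)).sub (((hasDerivAt_id w).mul ((hasDerivAt_stdTail w).pow 2)).add
      (((hasDerivAt_stdPDF w).pow 2).const_mul 2)) using 1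
    simp only [Pi.mul_apply, Pi.pow_apply, id_eq, Nat.cast_ofNat, Nat.add_one_sub_one, pow_one]
    ring
  · have h_mills : 0 ≤ stdPDF w - 2 * w * stdPDF w + 2 * w ^ 2 * stdTail w := by
      refine nonneg_of_mul_nonneg_right (a := 1 + w ^ 2) ?_ (by positivity)
      have h_sq : 0 ≤ stdPDF w * (1 - w) ^ 2 := mul_nonneg (stdPDF_pos w).le (sq_nonneg _)
      linarith [mul_le_mul_of_nonneg_left (mul_stdPDF_le w) (sq_nonneg w)]
    linarith [sq_nonneg (stdTail w - stdPDF w), mul_nonneg (stdPDF_pos w).le h_mills]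
  · have hp := tendsto_pow_mul_stdPDF
    have hT := tendsto_pow_mul_stdTail
    have h := ((((hp 0).add (hp 1)).const_mul 2).mul (hT 0)).sub
      (((hT 1).mul (hT 0)).add (((hp 0).pow 2).const_mul 2))
    simp only [add_zero, mul_zero, ne_eq, OfNat.ofNat_ne_zero, not_false_eq_true, zero_pow,
      sub_zero] at h
    exact h.congr fun x => by ring

theorem two_mul_stdExcess_mul_stdExcess_neg_le_of_nonneg {w : ℝ} (hw : 0 ≤ w) :
    2 * (stdExcess w * stdExcess (-w)) ≤ stdPDF w := by
  have h_excess : stdExcess w ^ 2 + 2 * w * stdPDF w * stdExcess w ≤ stdPDF w ^ 2 := by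
    have := mul_le_mul_of_nonneg_left (mul_sq_stdTail_add_le w) hw
    simp only [stdExcess]
    linarith
  have h_half := mul_le_mul_of_nonneg_right (stdPDF_le_half w) (sq_nonneg (stdExcess w))
  rw [stdExcess_neg]
  refine le_of_mul_le_mul_left (a := stdPDF w) ?_ (stdPDF_pos w)
  linarith

theorem two_mul_stdExcess_mul_stdExcess_neg_le (w : ℝ) :
    2 * (stdExcess w * stdExcess (-w)) ≤ stdPDF w := by
  rcases le_total 0 w with hw | hw
  · exact two_mul_stdExcess_mul_stdExcess_neg_le_of_nonneg hw
  · have h := two_mul_stdExcess_mul_stdExcess_neg_le_of_nonneg (neg_nonneg.2 hw)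
    rwa [neg_neg, stdPDF_neg, mul_comm (stdExcess (-w))] at h

end GaussianTail

section SteinSolution

open Set Filter Topology

theorem lipschitzWith_of_abs_hasDerivAt_le {f f' : ℝ → ℝ} {K : NNReal}
    (hf : ∀ x, HasDerivAt f (f' x) x) (hK : ∀ x, |f' x| ≤ K) : LipschitzWith K f :=
  lipschitzWith_of_nnnorm_deriv_le (fun x => (hf x).differentiableAt) fun x => by
    rw [(hf x).deriv]; exact hK x

theorem memLp_comp_of_lipschitzWith {Ω : Type*} [MeasurableSpace Ω] {μ : Measure Ω}
    [IsFiniteMeasure μ] {p : ℝ≥0∞} {K : NNReal} {f : ℝ → ℝ} (hf : LipschitzWith K f) {Y : Ω → ℝ}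
    (hY : MemLp Y p μ) : MemLp (fun ω => f (Y ω)) p μ := by
  have h_centered : LipschitzWith K fun x => f x - f 0 := by
    simpa only [add_zero, sub_eq_add_neg] using! hf.add (LipschitzWith.const (-f 0))
  exact ((h_centered.comp_memLp (sub_self _) hY).add (memLp_const (f 0))).ae_eq
    (Eventually.of_forall fun ω => sub_add_cancel _ _)

theorem memLp_gaussianReal_of_lipschitzWith {K : NNReal} {f : ℝ → ℝ} (hf : LipschitzWith K f)
    {p : ℝ≥0∞} (hp : p ≠ ∞) : MemLp f p (gaussianReal 0 1) :=
  memLp_comp_of_lipschitzWith hf (memLp_id_gaussianReal' p hp)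

theorem integrable_mul_stdPDF {f : ℝ → ℝ} (hf : Integrable f (gaussianReal 0 1)) :
    Integrable (fun x => f x * stdPDF x) := by
  rw [gaussianReal_of_var_ne_zero 0 one_ne_zero, integrable_withDensity_iff_integrable_smul'
    (measurable_gaussianPDF 0 1) (Eventually.of_forall fun _ => gaussianPDF_lt_top)] at hf
  simpa [toReal_gaussianPDF, mul_comm] using hf

theorem integral_deriv_sub_mul_gaussianReal {f : ℝ → ℝ} {K : NNReal} (hf : Differentiable ℝ f)
    (hK : LipschitzWith K f) : ∫ x, (deriv f x - x * f x) ∂gaussianReal 0 1 = 0 := by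
  have h_int_deriv : Integrable (deriv f) (gaussianReal 0 1) :=
    (integrable_const (K : ℝ)).mono' (measurable_deriv f).aestronglyMeasurable
      (Eventually.of_forall fun x => norm_deriv_le_of_lipschitz hK)
  have h_int : Integrable f (gaussianReal 0 1) :=
    (memLp_gaussianReal_of_lipschitzWith hK ENNReal.one_ne_top).integrable le_rfl
  have h_int_mul : Integrable (fun x => x * f x) (gaussianReal 0 1) :=
    MemLp.integrable_mul (p := 2) (q := 2)
      (memLp_gaussianReal_of_lipschitzWith LipschitzWith.id ENNReal.ofNat_ne_top)
      (memLp_gaussianReal_of_lipschitzWith hK ENNReal.ofNat_ne_top)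
  have h_parts := integral_mul_deriv_eq_deriv_mul_of_integrable (fun x _ => (hf x).hasDerivAt)
    (fun x _ => hasDerivAt_stdPDF x)
    ((integrable_mul_stdPDF h_int_mul).neg.congr (Eventually.of_forall fun x => by
      simp only [Pi.neg_apply, Pi.mul_apply]; ring))
    (integrable_mul_stdPDF h_int_deriv) (integrable_mul_stdPDF h_int)
  rw [integral_sub h_int_deriv h_int_mul, sub_eq_zero]
  simp only [integral_gaussianReal_eq_integral_smul one_ne_zero, smul_eq_mul]
  calc ∫ x, stdPDF x * deriv f x = -∫ x, f x * (-x * stdPDF x) := by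
        rw [h_parts, neg_neg]; simp only [mul_comm]
    _ = ∫ x, stdPDF x * (x * f x) := by
        rw [← integral_neg]; exact integral_congr_ae (Eventually.of_forall fun x => by ring)

/-- The integral `∫_w^∞ g(t) T(t) dt` against the normal tail `T`. -/
noncomputable def tailIntegral (g : ℝ → ℝ) (w : ℝ) : ℝ := ∫ t in Ioi w, g t * stdTail t

theorem integrableOn_stdTail (w : ℝ) : IntegrableOn stdTail (Ioi w) := by
  have h := integrableOn_Ioi_deriv_of_nonpos' (a := w) (fun x _ => hasDerivAt_stdExcess x)
    (fun x _ => neg_nonpos.2 (stdTail_nonneg x)) tendsto_stdExcess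
  simpa using! h.neg

theorem integral_stdTail (w : ℝ) : ∫ t in Ioi w, stdTail t = stdExcess w := by
  have h := integral_Ioi_of_hasDerivAt_of_nonpos' (a := w) (fun x _ => hasDerivAt_stdExcess x)
    (fun x _ => neg_nonpos.2 (stdTail_nonneg x)) tendsto_stdExcess
  rw [integral_neg] at h
  linarith

/-- The solution of the Stein equation for a function with derivative `g`: the Fubini form
`-(T(w) ∫_{-∞}^w g(t) T(-t) dt + T(-w) ∫_w^∞ g(t) T(t) dt) / p(w)` of the classical formula,
where `p` and `T` are the normal density and tail. -/
noncomputable def steinSol (g : ℝ → ℝ) (w : ℝ) : ℝ :=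
  -(stdTail w * tailIntegral (fun t => g (-t)) (-w) + stdTail (-w) * tailIntegral g w) / stdPDF w

/-- The right-hand side of the Stein equation solved by `steinSol g`: the antiderivative of `g`
with mean zero under the standard normal law. -/
noncomputable def steinRhs (g : ℝ → ℝ) (w : ℝ) : ℝ :=
  tailIntegral (fun t => g (-t)) (-w) - tailIntegral g w

theorem norm_mul_stdTail_le {g : ℝ → ℝ} (hb : ∀ x, |g x| ≤ 1) (t : ℝ) :
    ‖g t * stdTail t‖ ≤ stdTail t := by
  rw [norm_mul, Real.norm_eq_abs, Real.norm_of_nonneg (stdTail_nonneg t)]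
  exact mul_le_of_le_one_left (stdTail_nonneg t) (hb t)

theorem abs_tailIntegral_le {g : ℝ → ℝ} (hb : ∀ x, |g x| ≤ 1) (w : ℝ) :
    |tailIntegral g w| ≤ stdExcess w := by
  rw [← integral_stdTail]
  exact norm_integral_le_of_norm_le (integrableOn_stdTail w)
    (Eventually.of_forall (norm_mul_stdTail_le hb))

theorem abs_mul_tailIntegral_add_mul_tailIntegral_le {g : ℝ → ℝ} (hb : ∀ x, |g x| ≤ 1) (a b w : ℝ) :
    |a * tailIntegral (fun t => g (-t)) (-w) + b * tailIntegral g w|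
      ≤ |a| * stdExcess (-w) + |b| * stdExcess w := by
  refine (abs_add_le _ _).trans ?_
  rw [abs_mul, abs_mul]
  gcongr
  exacts [abs_tailIntegral_le (fun x => hb _) _, abs_tailIntegral_le hb _]

section Derivatives

variable {g : ℝ → ℝ} (hg : Continuous g) (hb : ∀ x, |g x| ≤ 1) (w : ℝ)
include hg hb

theorem hasDerivAt_tailIntegral : HasDerivAt (tailIntegral g) (-(g w * stdTail w)) w :=
  hasDerivAt_integral_Ioi (hg.mul continuous_stdTail) (fun a =>
    (integrableOn_stdTail a).mono' (hg.mul continuous_stdTail).aestronglyMeasurable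
      (Eventually.of_forall (norm_mul_stdTail_le hb))) w

theorem hasDerivAt_tailIntegral_comp_neg :
    HasDerivAt (fun w => tailIntegral (fun t => g (-t)) (-w)) (g w * stdTail (-w)) w := by
  convert! (hasDerivAt_tailIntegral (hg.comp continuous_neg) (fun x => hb _) (-w)).comp w
    (hasDerivAt_neg w) using 1
  simp

theorem hasDerivAt_steinRhs : HasDerivAt (steinRhs g) (g w) w := by
  convert! (hasDerivAt_tailIntegral_comp_neg hg hb w).sub (hasDerivAt_tailIntegral hg hb w) using 1
  linear_combination (-g w) * stdTail_add_stdTail_neg w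

theorem hasDerivAt_steinSol : HasDerivAt (steinSol g) (w * steinSol g w + steinRhs g w) w := by
  have h_reflect : HasDerivAt (fun w => stdTail (-w)) (stdPDF w) w := by
    convert! (hasDerivAt_stdTail (-w)).comp w (hasDerivAt_neg w) using 1
    simp [stdPDF_neg]
  have hp : stdPDF w ≠ 0 := (stdPDF_pos w).ne'
  convert! (((hasDerivAt_stdTail w).mul (hasDerivAt_tailIntegral_comp_neg hg hb w)).add
    (h_reflect.mul (hasDerivAt_tailIntegral hg hb w))).neg.div (hasDerivAt_stdPDF w) hp using 1
  simp only [steinSol, steinRhs, Pi.neg_apply, Pi.add_apply, Pi.mul_apply]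
  field_simp
  ring

theorem hasDerivAt_mul_steinSol_add_steinRhs :
    HasDerivAt (fun w => w * steinSol g w + steinRhs g w)
      (steinSol g w + w * (w * steinSol g w + steinRhs g w) + g w) w := by
  convert! ((hasDerivAt_id w).mul (hasDerivAt_steinSol hg hb w)).add
    (hasDerivAt_steinRhs hg hb w) using 1
  simp

end Derivatives

theorem abs_mul_steinSol_add_steinRhs_le {g : ℝ → ℝ} (hb : ∀ x, |g x| ≤ 1) (w : ℝ) :
    |w * steinSol g w + steinRhs g w| ≤ 1 := by
  have hp := stdPDF_pos w
  have h_eq : w * steinSol g w + steinRhs g w =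
      (stdExcess w * tailIntegral (fun t => g (-t)) (-w)
        + -stdExcess (-w) * tailIntegral g w) / stdPDF w := by
    simp only [steinSol, steinRhs, stdExcess, stdPDF_neg]
    field_simp
    ring
  rw [h_eq, abs_div, abs_of_pos hp, div_le_one hp]
  calc _ ≤ |stdExcess w| * stdExcess (-w) + |-stdExcess (-w)| * stdExcess w :=
        abs_mul_tailIntegral_add_mul_tailIntegral_le hb _ _ _
    _ = 2 * (stdExcess w * stdExcess (-w)) := by
        rw [abs_neg, abs_of_nonneg (stdExcess_nonneg _), abs_of_nonneg (stdExcess_nonneg _)]; ring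
    _ ≤ stdPDF w := two_mul_stdExcess_mul_stdExcess_neg_le w

theorem abs_steinSol_add_mul_le {g : ℝ → ℝ} (hb : ∀ x, |g x| ≤ 1) (w : ℝ) :
    |steinSol g w + w * (w * steinSol g w + steinRhs g w)| ≤ 1 := by
  have hp := stdPDF_pos w
  set a := (1 + w ^ 2) * stdTail w - w * stdPDF w with ha
  set b := (1 + w ^ 2) * stdTail (-w) + w * stdPDF w with hb'
  have ha_nonneg : 0 ≤ a := sub_nonneg.2 (mul_stdPDF_le w)
  have hb_nonneg : 0 ≤ b := by
    have h := mul_stdPDF_le (-w)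
    rw [stdPDF_neg, neg_sq] at h
    linarith
  have h_eq : steinSol g w + w * (w * steinSol g w + steinRhs g w) =
      -(a * tailIntegral (fun t => g (-t)) (-w) + b * tailIntegral g w) / stdPDF w := by
    simp only [steinSol, steinRhs, ha, hb']
    field_simp
    ring
  rw [h_eq, abs_div, abs_of_pos hp, div_le_one hp, abs_neg]
  calc _ ≤ |a| * stdExcess (-w) + |b| * stdExcess w :=
        abs_mul_tailIntegral_add_mul_tailIntegral_le hb _ _ _
    _ = stdPDF w := by
        rw [abs_of_nonneg ha_nonneg, abs_of_nonneg hb_nonneg, ha, hb']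
        simp only [stdExcess, stdPDF_neg]
        linear_combination stdPDF w * stdTail_add_stdTail_neg w

theorem lipschitzWith_steinSol {g : ℝ → ℝ} (hg : Continuous g) (hb : ∀ x, |g x| ≤ 1) :
    LipschitzWith 1 (steinSol g) :=
  lipschitzWith_of_abs_hasDerivAt_le (hasDerivAt_steinSol hg hb) fun x =>
    abs_mul_steinSol_add_steinRhs_le hb x

theorem lipschitzWith_steinRhs {g : ℝ → ℝ} (hg : Continuous g) (hb : ∀ x, |g x| ≤ 1) :
    LipschitzWith 1 (steinRhs g) :=
  lipschitzWith_of_abs_hasDerivAt_le (hasDerivAt_steinRhs hg hb) hb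

theorem deriv_steinSol {g : ℝ → ℝ} (hg : Continuous g) (hb : ∀ x, |g x| ≤ 1) :
    deriv (steinSol g) = fun w => w * steinSol g w + steinRhs g w :=
  funext fun w => (hasDerivAt_steinSol hg hb w).deriv

theorem lipschitzWith_deriv_steinSol {g : ℝ → ℝ} (hg : Continuous g) (hb : ∀ x, |g x| ≤ 1) :
    LipschitzWith 2 (deriv (steinSol g)) := by
  rw [deriv_steinSol hg hb]
  refine lipschitzWith_of_abs_hasDerivAt_le (hasDerivAt_mul_steinSol_add_steinRhs hg hb) fun x => ?_
  refine (abs_add_le _ _).trans ((add_le_add (abs_steinSol_add_mul_le hb x) (hb x)).trans ?_)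
  norm_num

theorem integral_steinRhs {g : ℝ → ℝ} (hg : Continuous g) (hb : ∀ x, |g x| ≤ 1) :
    ∫ x, steinRhs g x ∂gaussianReal 0 1 = 0 := by
  have h := integral_deriv_sub_mul_gaussianReal
    (fun x => (hasDerivAt_steinSol hg hb x).differentiableAt) (lipschitzWith_steinSol hg hb)
  simpa only [deriv_steinSol hg hb, add_sub_cancel_left] using h

theorem steinRhs_deriv {h : ℝ → ℝ} (hh : ContDiff ℝ 1 h) (h_lip : LipschitzWith 1 h) (x : ℝ) :
    steinRhs (deriv h) x = h x - ∫ y, h y ∂gaussianReal 0 1 := by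
  have hg : Continuous (deriv h) := hh.continuous_deriv le_rfl
  have hb : ∀ x, |deriv h x| ≤ 1 := fun x => norm_deriv_le_of_lipschitz h_lip
  have hd : ∀ y, HasDerivAt (fun y => h y - steinRhs (deriv h) y) 0 y := fun y => by
    simpa using! (hh.differentiable one_ne_zero y).hasDerivAt.sub (hasDerivAt_steinRhs hg hb y)
  have h_const : ∀ y, h y - steinRhs (deriv h) y = h x - steinRhs (deriv h) x := fun y =>
    is_const_of_deriv_eq_zero (fun y => (hd y).differentiableAt) (fun y => (hd y).deriv) y x
  have h_int {f : ℝ → ℝ} (hf : LipschitzWith 1 f) : Integrable f (gaussianReal 0 1) :=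
    (memLp_gaussianReal_of_lipschitzWith hf ENNReal.one_ne_top).integrable le_rfl
  have h_mean : ∫ y, (h y - steinRhs (deriv h) y) ∂gaussianReal 0 1
      = h x - steinRhs (deriv h) x := by
    simp only [h_const, integral_const, probReal_univ, one_smul]
  rw [integral_sub (h_int h_lip) (h_int (lipschitzWith_steinRhs hg hb)),
    integral_steinRhs hg hb] at h_mean
  linarith

/-- The regularity class of the solutions of the Stein equation for continuously differentiable
functions that are Lipschitz with constant `1`. -/
structure IsSteinTest (f : ℝ → ℝ) : Prop where
  differentiable : Differentiable ℝ f
  lipschitz : LipschitzWith 1 f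
  lipschitz_deriv : LipschitzWith 2 (deriv f)

theorem exists_stein_solution {h : ℝ → ℝ} (hh : ContDiff ℝ 1 h) (h_lip : LipschitzWith 1 h) :
    ∃ f, IsSteinTest f ∧ ∀ x, deriv f x - x * f x = h x - ∫ y, h y ∂gaussianReal 0 1 := by
  have hg : Continuous (deriv h) := hh.continuous_deriv le_rfl
  have hb : ∀ x, |deriv h x| ≤ 1 := fun x => norm_deriv_le_of_lipschitz h_lip
  refine ⟨steinSol (deriv h), ⟨fun x => (hasDerivAt_steinSol hg hb x).differentiableAt,
    lipschitzWith_steinSol hg hb, lipschitzWith_deriv_steinSol hg hb⟩, fun x => ?_⟩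
  rw [deriv_steinSol hg hb, add_sub_cancel_left, steinRhs_deriv hh h_lip]

end SteinSolution

section SteinMethod

open Set

theorem norm_inv_smul_intervalIntegral_sub_le {E : Type*} [NormedAddCommGroup E]
    [NormedSpace ℝ E] [CompleteSpace E] {h : ℝ → E} {K : NNReal} (hh : LipschitzWith K h) {ε : ℝ}
    (hε : 0 < ε) (x : ℝ) : ‖ε⁻¹ • (∫ t in x..(x + ε), h t) - h x‖ ≤ K * ε := by
  have h_center : ε⁻¹ • (∫ t in x..(x + ε), h t) - h x
      = ε⁻¹ • ∫ t in x..(x + ε), (h t - h x) := by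
    rw [intervalIntegral.integral_sub (hh.continuous.intervalIntegrable _ _) (by simp),
      intervalIntegral.integral_const, add_sub_cancel_left, smul_sub, inv_smul_smul₀ hε.ne']
  have h_bound : ‖∫ t in x..(x + ε), (h t - h x)‖ ≤ K * ε * |x + ε - x| := by
    refine intervalIntegral.norm_integral_le_of_norm_le_const fun t ht => ?_
    rw [uIoc_of_le (by linarith)] at ht
    refine (hh.norm_sub_le t x).trans ?_
    gcongr
    rw [Real.norm_of_nonneg (by linarith [ht.1])]
    linarith [ht.2]
  rw [add_sub_cancel_left, abs_of_pos hε] at h_bound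
  rw [h_center, norm_smul, norm_inv, Real.norm_of_nonneg hε.le, inv_mul_le_iff₀ hε]
  linarith

/-- The moving average `x ↦ ε⁻¹ ∫_x^{x+ε} h`. -/
noncomputable def movingAverage (ε : ℝ) (h : ℝ → ℝ) (x : ℝ) : ℝ := ε⁻¹ * ∫ t in x..(x + ε), h t

theorem hasDerivAt_movingAverage {h : ℝ → ℝ} (hh : Continuous h) (ε x : ℝ) :
    HasDerivAt (movingAverage ε h) (ε⁻¹ * (h (x + ε) - h x)) x := by
  have h_prim : ∀ y, HasDerivAt (fun u => ∫ t in (0 : ℝ)..u, h t) (h y) y := fun y =>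
    intervalIntegral.integral_hasDerivAt_right (hh.intervalIntegrable 0 y)
      hh.stronglyMeasurable.stronglyMeasurableAtFilter hh.continuousAt
  have h_eq : movingAverage ε h
      = fun x => ε⁻¹ * ((∫ t in (0 : ℝ)..(x + ε), h t) - ∫ t in (0 : ℝ)..x, h t) := by
    funext y
    rw [intervalIntegral.integral_interval_sub_left (hh.intervalIntegrable _ _)
      (hh.intervalIntegrable _ _), movingAverage]
  rw [h_eq]
  exact (((h_prim (x + ε)).comp_add_const x ε).sub (h_prim x)).const_mul ε⁻¹

theorem contDiff_movingAverage {h : ℝ → ℝ} (hh : Continuous h) (ε : ℝ) :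
    ContDiff ℝ 1 (movingAverage ε h) := by
  refine contDiff_one_iff_deriv.2
    ⟨fun x => (hasDerivAt_movingAverage hh ε x).differentiableAt, ?_⟩
  rw [funext fun x => (hasDerivAt_movingAverage hh ε x).deriv]
  fun_prop

theorem lipschitzWith_movingAverage {h : ℝ → ℝ} {K : NNReal} (hh : LipschitzWith K h) {ε : ℝ}
    (hε : 0 < ε) : LipschitzWith K (movingAverage ε h) := by
  refine lipschitzWith_of_abs_hasDerivAt_le (hasDerivAt_movingAverage hh.continuous ε) fun x => ?_
  have h_sub := hh.norm_sub_le (x + ε) x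
  rw [add_sub_cancel_left, Real.norm_of_nonneg hε.le] at h_sub
  rw [abs_mul, abs_inv, abs_of_pos hε, inv_mul_le_iff₀ hε, mul_comm]
  exact h_sub

theorem integrable_of_lipschitzWith {μ : Measure ℝ} [IsFiniteMeasure μ]
    (hμ : Integrable (fun x => x) μ) {h : ℝ → ℝ} {K : NNReal} (hh : LipschitzWith K h) :
    Integrable h μ :=
  (memLp_comp_of_lipschitzWith hh (memLp_one_iff_integrable.2 hμ)).integrable le_rfl

theorem abs_integral_movingAverage_sub_le {μ : Measure ℝ} [IsProbabilityMeasure μ]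
    (hμ : Integrable (fun x => x) μ) {h : ℝ → ℝ} {K : NNReal} (hh : LipschitzWith K h) {ε : ℝ}
    (hε : 0 < ε) : |∫ x, movingAverage ε h x ∂μ - ∫ x, h x ∂μ| ≤ K * ε := by
  rw [← integral_sub (integrable_of_lipschitzWith hμ (lipschitzWith_movingAverage hh hε))
    (integrable_of_lipschitzWith hμ hh)]
  simpa [movingAverage] using norm_integral_le_of_norm_le_const (μ := μ)
    (.of_forall fun x => norm_inv_smul_intervalIntegral_sub_le hh hε x)

theorem wassersteinDist_gaussianReal_le {μ : Measure ℝ} [IsProbabilityMeasure μ]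
    (hμ : Integrable (fun x => x) μ) {C : ℝ}
    (hC : ∀ f, IsSteinTest f → |∫ x, (deriv f x - x * f x) ∂μ| ≤ C) :
    wassersteinDist μ (gaussianReal 0 1) ≤ ENNReal.ofReal C := by
  refine iSup₂_le fun h hh => ENNReal.ofReal_le_ofReal (le_of_forall_pos_le_add fun δ hδ => ?_)
  have hε : 0 < δ / 2 := half_pos hδ
  set H := movingAverage (δ / 2) h
  have hH : LipschitzWith 1 H := lipschitzWith_movingAverage hh hε
  have h_gauss : Integrable (fun x : ℝ => x) (gaussianReal 0 1) :=
    (memLp_id_gaussianReal' 1 ENNReal.one_ne_top).integrable le_rfl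
  obtain ⟨f, hf, h_stein⟩ := exists_stein_solution (contDiff_movingAverage hh.continuous _) hH
  have h_smooth : |∫ x, H x ∂μ - ∫ x, H x ∂gaussianReal 0 1| ≤ C := by
    have h := hC f hf
    simp only [h_stein] at h
    rwa [integral_sub (integrable_of_lipschitzWith hμ hH) (integrable_const _), integral_const,
      probReal_univ, one_smul] at h
  have h_μ := abs_integral_movingAverage_sub_le hμ hh hε
  have h_γ := abs_integral_movingAverage_sub_le h_gauss hh hε
  rw [NNReal.coe_one, one_mul, abs_le] at h_μ h_γ
  rw [abs_le] at h_smooth ⊢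
  constructor <;> linarith [h_μ.1, h_μ.2, h_γ.1, h_γ.2, h_smooth.1, h_smooth.2]

end SteinMethod

section ZeroBias

open Set

theorem abs_sub_sub_deriv_mul_le {f : ℝ → ℝ} {K : NNReal} (hf : Differentiable ℝ f)
    (hK : LipschitzWith K (deriv f)) (x y : ℝ) :
    |f y - f x - deriv f x * (y - x)| ≤ K * (y - x) ^ 2 / 2 := by
  set d := y - x with hd
  have h_line : ∀ u : ℝ, HasDerivAt (fun u => f (x + u * d) - f x - deriv f x * (u * d))
      (deriv f (x + u * d) * d - deriv f x * d) u := fun u => by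
    have h_arg : HasDerivAt (fun u : ℝ => u * d) d u := by
      simpa using (hasDerivAt_id u).mul_const d
    exact (((hf _).hasDerivAt.comp u (h_arg.const_add x)).sub_const (f x)).sub
      (h_arg.const_mul (deriv f x))
  have h_quad : ∀ u : ℝ, HasDerivAt (fun u => K * d ^ 2 * u ^ 2 / 2) (K * d ^ 2 * u) u :=
      fun u => by
    convert! ((hasDerivAt_pow 2 u).const_mul (K * d ^ 2)).div_const 2 using 1
    simp only [Nat.cast_ofNat, Nat.add_one_sub_one, pow_one]
    ring
  have h_bound : ∀ u ∈ Ico (0 : ℝ) 1,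
      ‖deriv f (x + u * d) * d - deriv f x * d‖ ≤ K * d ^ 2 * u := fun u hu => by
    rw [← sub_mul, norm_mul]
    calc _ ≤ K * ‖x + u * d - x‖ * ‖d‖ := by gcongr; exact hK.norm_sub_le _ _
      _ = K * d ^ 2 * u := by
        rw [add_sub_cancel_left, norm_mul, Real.norm_of_nonneg hu.1, ← sq_abs d, Real.norm_eq_abs]
        ring
  have h := image_norm_le_of_norm_deriv_right_le_deriv_boundary
    (fun u _ => (h_line u).continuousAt.continuousWithinAt)
    (fun u _ => (h_line u).hasDerivWithinAt) (by simp) h_quad h_bound (right_mem_Icc.2 zero_le_one)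
  simpa [hd] using h

-- Both `f(x)` and `f(0)` are compared with `f(θx)`; the coefficients of `f'(x)` and `f'(0)` left
-- over by the two Taylor expansions then combine into `((1 - θ) x² - 1) (f'(x) - f'(0))`.
theorem abs_mul_sub_deriv_sub_le_of_interpolation {f : ℝ → ℝ} {K : NNReal}
    (hf : Differentiable ℝ f) (hK : LipschitzWith K (deriv f)) (x θ : ℝ) :
    |x * f x - deriv f x - f 0 * x - deriv f 0 * (x ^ 2 - 1)|
      ≤ K * ((θ ^ 2 + (1 - θ) ^ 2) / 2 * |x| ^ 3 + |(1 - θ) * |x| ^ 2 - 1| * |x|) := by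
  have h_zero := abs_sub_sub_deriv_mul_le hf hK 0 (θ * x)
  have h_x := abs_sub_sub_deriv_mul_le hf hK x (θ * x)
  have h_deriv : |deriv f x - deriv f 0| ≤ K * |x| := by simpa using hK.norm_sub_le x 0
  set R₀ := f (θ * x) - f 0 - deriv f 0 * (θ * x - 0)
  set R₁ := f (θ * x) - f x - deriv f x * (θ * x - x)
  calc |x * f x - deriv f x - f 0 * x - deriv f 0 * (x ^ 2 - 1)|
      = |x * R₀ + -(x * R₁) + ((1 - θ) * |x| ^ 2 - 1) * (deriv f x - deriv f 0)| := by
        rw [sq_abs]; congr 1; ring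
    _ ≤ |x| * |R₀| + |x| * |R₁| + |(1 - θ) * |x| ^ 2 - 1| * |deriv f x - deriv f 0| := by
        refine (abs_add_three _ _ _).trans_eq ?_
        rw [abs_neg, abs_mul, abs_mul, abs_mul]
    _ ≤ |x| * (K * (θ * x - 0) ^ 2 / 2) + |x| * (K * (θ * x - x) ^ 2 / 2)
          + |(1 - θ) * |x| ^ 2 - 1| * (K * |x|) := by gcongr
    _ = _ := by
        rw [← sq_abs (θ * x - 0), ← sq_abs (θ * x - x), sub_zero, abs_mul,
          show θ * x - x = -((1 - θ) * x) by ring, abs_neg, abs_mul, mul_pow, mul_pow, sq_abs θ,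
          sq_abs (1 - θ)]
        ring

theorem exists_interpolation_le {a : ℝ} (ha : 0 ≤ a) :
    ∃ θ : ℝ, (θ ^ 2 + (1 - θ) ^ 2) / 2 * a ^ 3 + |(1 - θ) * a ^ 2 - 1| * a
      ≤ 2 / 3 * (a ^ 3 - (a ^ 2 - 1)) := by
  rcases le_total a 1 with h | h
  · refine ⟨0, ?_⟩
    rw [abs_of_nonpos (by nlinarith)]
    nlinarith [mul_nonneg ha (sq_nonneg (a - 4 / 5)), sq_nonneg (a - 4 / 5)]
  · refine ⟨1 - (a ^ 2)⁻¹, ?_⟩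
    have : 0 < a := one_pos.trans_le h
    have h_left : ((1 - (a ^ 2)⁻¹) ^ 2 + (a ^ 2)⁻¹ ^ 2) / 2 * a ^ 3
        = (a ^ 4 - 2 * a ^ 2 + 2) / (2 * a) := by field_simp; ring
    rw [sub_sub_cancel, inv_mul_cancel₀ (by positivity), sub_self, abs_zero, zero_mul, add_zero,
      h_left, div_le_iff₀ (by positivity)]
    nlinarith [sq_nonneg ((a - 1) ^ 2)]

theorem abs_mul_sub_deriv_sub_le {f : ℝ → ℝ} {K : NNReal} (hf : Differentiable ℝ f)
    (hK : LipschitzWith K (deriv f)) (x : ℝ) :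
    |x * f x - deriv f x - f 0 * x - deriv f 0 * (x ^ 2 - 1)|
      ≤ 2 / 3 * K * (|x| ^ 3 - (x ^ 2 - 1)) := by
  obtain ⟨θ, hθ⟩ := exists_interpolation_le (abs_nonneg x)
  calc _ ≤ _ := abs_mul_sub_deriv_sub_le_of_interpolation hf hK x θ
    _ ≤ K * (2 / 3 * (|x| ^ 3 - (|x| ^ 2 - 1))) := by gcongr
    _ = 2 / 3 * K * (|x| ^ 3 - (x ^ 2 - 1)) := by rw [sq_abs]; ring

theorem abs_integral_mul_sub_deriv_le {μ : Measure ℝ} [IsProbabilityMeasure μ]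
    (hμ : MemLp (fun x => x) 3 μ) (h_mean : ∫ x, x ∂μ = 0) (h_var : ∫ x, x ^ 2 ∂μ = 1)
    {f : ℝ → ℝ} {K : NNReal} (hf : Differentiable ℝ f) (hK : LipschitzWith K (deriv f)) :
    |∫ x, (x * f x - deriv f x) ∂μ| ≤ 2 / 3 * K * ∫ x, |x| ^ 3 ∂μ := by
  by_cases h_int : Integrable (fun x => x * f x - deriv f x) μ
  swap
  · rw [integral_undef h_int, abs_zero]; positivity
  have h_sq : Integrable (fun x : ℝ => x ^ 2) μ := (hμ.mono_exponent (by norm_num)).integrable_sq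
  have h_cube : Integrable (fun x : ℝ => |x| ^ 3) μ := hμ.integrable_norm_pow (by norm_num)
  have h_lin : Integrable (fun x => f 0 * x) μ := (hμ.integrable (by norm_num)).const_mul (f 0)
  have h_var_sub : Integrable (fun x : ℝ => x ^ 2 - 1) μ := h_sq.sub (integrable_const 1)
  have h_var_zero : ∫ x, (x ^ 2 - 1) ∂μ = 0 := by
    rw [integral_sub h_sq (integrable_const 1), h_var]; simp
  have h_left : ∫ x, (x * f x - deriv f x - f 0 * x - deriv f 0 * (x ^ 2 - 1)) ∂μ
      = ∫ x, (x * f x - deriv f x) ∂μ := by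
    have h_sub : Integrable (fun x => x * f x - deriv f x - f 0 * x) μ := h_int.sub h_lin
    rw [integral_sub h_sub (h_var_sub.const_mul _), integral_sub h_int h_lin,
      integral_const_mul, integral_const_mul, h_mean, h_var_zero]
    ring
  have h_right : ∫ x, 2 / 3 * K * (|x| ^ 3 - (x ^ 2 - 1)) ∂μ = 2 / 3 * K * ∫ x, |x| ^ 3 ∂μ := by
    rw [integral_const_mul, integral_sub h_cube h_var_sub, h_var_zero, sub_zero]
  have h_bound : Integrable (fun x : ℝ => 2 / 3 * K * (|x| ^ 3 - (x ^ 2 - 1))) μ :=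
    (h_cube.sub h_var_sub).const_mul _
  rw [← h_left, ← h_right, ← Real.norm_eq_abs]
  exact norm_integral_le_of_norm_le h_bound (.of_forall fun x => abs_mul_sub_deriv_sub_le hf hK x)

theorem abs_integral_mul_comp_affine_sub_le {μ : Measure ℝ} [IsProbabilityMeasure μ]
    (hμ : MemLp (fun x => x) 3 μ) (h_mean : ∫ x, x ∂μ = 0) (h_var : ∫ x, x ^ 2 ∂μ = 1)
    {f : ℝ → ℝ} {K : NNReal} (hf : Differentiable ℝ f) (hK : LipschitzWith K (deriv f))
    (v w : ℝ) :
    |∫ x, (x * v * f (w + x * v) - v ^ 2 * deriv f (w + x * v)) ∂μ|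
      ≤ 2 / 3 * K * (∫ x, |x| ^ 3 ∂μ) * |v| ^ 3 := by
  have hd : ∀ x, HasDerivAt (fun x => v * f (w + x * v)) (v * (deriv f (w + x * v) * v)) x :=
    fun x => by
      have h_arg : HasDerivAt (fun x : ℝ => w + x * v) v x := by
        simpa using ((hasDerivAt_id x).mul_const v).const_add w
      exact ((hf _).hasDerivAt.comp x h_arg).const_mul v
  have h_deriv : deriv (fun x => v * f (w + x * v)) = fun x => v ^ 2 * deriv f (w + x * v) := by
    funext x; rw [(hd x).deriv]; ring
  have h_lip : LipschitzWith (K * Real.nnabs v ^ 3) (deriv fun x => v * f (w + x * v)) := by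
    refine LipschitzWith.of_dist_le_mul fun x y => ?_
    have h := hK.norm_sub_le (w + x * v) (w + y * v)
    rw [add_sub_add_left_eq_sub, ← sub_mul, norm_mul] at h
    simp only [h_deriv, dist_eq_norm, ← mul_sub, norm_mul, norm_pow, NNReal.coe_mul,
      NNReal.coe_pow, Real.coe_nnabs]
    calc ‖v‖ ^ 2 * ‖deriv f (w + x * v) - deriv f (w + y * v)‖
        ≤ ‖v‖ ^ 2 * (K * (‖x - y‖ * ‖v‖)) := by gcongr
      _ = K * |v| ^ 3 * ‖x - y‖ := by rw [Real.norm_eq_abs v]; ring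
  have h := abs_integral_mul_sub_deriv_le hμ h_mean h_var (fun x => (hd x).differentiableAt) h_lip
  simp only [h_deriv, ← mul_assoc, NNReal.coe_mul, NNReal.coe_pow, Real.coe_nnabs] at h
  linarith

theorem abs_integral_mul_comp_add_sub_le {Ω : Type*} [MeasurableSpace Ω] {P : Measure Ω}
    [IsProbabilityMeasure P] {Z V W : Ω → ℝ} (hZ : MemLp Z 3 P) (hV : MemLp V 3 P)
    (hW : AEMeasurable W P) (h_indep : IndepFun Z (fun ω => (V ω, W ω)) P)
    (h_mean : ∫ ω, Z ω ∂P = 0) (h_var : ∫ ω, Z ω ^ 2 ∂P = 1) {f : ℝ → ℝ} {K : NNReal}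
    (hf : Differentiable ℝ f) (hK : LipschitzWith K (deriv f)) :
    |∫ ω, (Z ω * V ω * f (W ω + Z ω * V ω) - V ω ^ 2 * deriv f (W ω + Z ω * V ω)) ∂P|
      ≤ 2 / 3 * K * (∫ ω, |Z ω| ^ 3 ∂P) * ∫ ω, |V ω| ^ 3 ∂P := by
  have hZm : AEMeasurable Z P := hZ.aestronglyMeasurable.aemeasurable
  have hVm : AEMeasurable V P := hV.aestronglyMeasurable.aemeasurable
  have hU : AEMeasurable (fun ω => (V ω, W ω)) P := hVm.prodMk hW
  have := Measure.isProbabilityMeasure_map hZm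
  have := Measure.isProbabilityMeasure_map hU
  have h_law := (indepFun_iff_map_prod_eq_prod_map_map hU hZm).1 h_indep.symm
  set μ := P.map Z
  set F : (ℝ × ℝ) × ℝ → ℝ := fun q => q.2 * q.1.1 * f (q.1.2 + q.2 * q.1.1)
    - q.1.1 ^ 2 * deriv f (q.1.2 + q.2 * q.1.1)
  have hF : Measurable F := by
    have := hf.continuous
    have := hK.continuous
    exact Continuous.measurable (by fun_prop)
  have h_map {g : ℝ → ℝ} (hg : Continuous g) : ∫ x, g x ∂μ = ∫ ω, g (Z ω) ∂P :=
    integral_map hZm hg.aestronglyMeasurable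
  have h_inner := abs_integral_mul_comp_affine_sub_le (μ := μ)
    ((memLp_map_measure_iff aestronglyMeasurable_id hZm).2 hZ)
    ((h_map continuous_id).trans h_mean) ((h_map (continuous_pow 2)).trans h_var) hf hK
  rw [h_map (by fun_prop)] at h_inner
  by_cases h_int : Integrable F ((P.map fun ω => (V ω, W ω)).prod μ)
  swap
  · rw [← h_law, integrable_map_measure hF.aestronglyMeasurable (hU.prodMk hZm)] at h_int
    rw [integral_undef (by exact h_int), abs_zero]
    positivity
  calc _ = |∫ u, ∫ x, F (u, x) ∂μ ∂P.map fun ω => (V ω, W ω)| := by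
        rw [← integral_prod F h_int, ← h_law,
          integral_map (hU.prodMk hZm) hF.aestronglyMeasurable]
    _ ≤ ∫ u, 2 / 3 * K * (∫ ω, |Z ω| ^ 3 ∂P) * |u.1| ^ 3 ∂P.map fun ω => (V ω, W ω) := by
        have h_dom : Integrable (fun u : ℝ × ℝ => |u.1| ^ 3) (P.map fun ω => (V ω, W ω)) :=
          (integrable_map_measure (Continuous.aestronglyMeasurable (by fun_prop)) hU).2
            (hV.integrable_norm_pow (by norm_num))
        rw [← Real.norm_eq_abs]
        refine norm_integral_le_of_norm_le (h_dom.const_mul _) (.of_forall fun u => ?_)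
        exact h_inner u.1 u.2
    _ = _ := by
        rw [integral_const_mul, integral_map hU (Continuous.aestronglyMeasurable (by fun_prop))]

end ZeroBias

section Moments

theorem integral_abs_mul_abs_le {Ω : Type*} [MeasurableSpace Ω] {μ : Measure Ω} {f g : Ω → ℝ}
    (hf : MemLp f 2 μ) (hg : MemLp g 2 μ) :
    ∫ x, |f x| * |g x| ∂μ ≤ √(∫ x, f x ^ 2 ∂μ) * √(∫ x, g x ^ 2 ∂μ) := by
  have h := integral_mul_norm_le_Lp_mul_Lq (μ := μ) (f := f) (g := g) Real.HolderConjugate.two_two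
    (by simpa using hf) (by simpa using hg)
  simpa only [Real.norm_eq_abs, Real.rpow_two, sq_abs, Real.sqrt_eq_rpow] using h

theorem memLp_two_mul {Ω : Type*} [MeasurableSpace Ω] {μ : Measure Ω} {f g : Ω → ℝ}
    (hf : MemLp f 4 μ) (hg : MemLp g 4 μ) : MemLp (fun x => f x * g x) 2 μ := by
  have : ENNReal.HolderTriple 4 4 2 := ⟨by
    rw [← ENNReal.toReal_eq_toReal_iff' (by simp) (by simp), ENNReal.toReal_add (by simp) (by simp)]
    norm_num⟩
  exact hg.mul hf

theorem integral_abs_le_sqrt {Ω : Type*} [MeasurableSpace Ω] {μ : Measure Ω}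
    [IsProbabilityMeasure μ] {f : Ω → ℝ} (hf : MemLp f 2 μ) :
    ∫ x, |f x| ∂μ ≤ √(∫ x, f x ^ 2 ∂μ) := by
  simpa using integral_abs_mul_abs_le hf (memLp_const (1 : ℝ))

theorem integral_abs_pow_three_le {Ω : Type*} [MeasurableSpace Ω] {μ : Measure Ω}
    [IsFiniteMeasure μ] {f : Ω → ℝ} (hf : MemLp f 4 μ) :
    ∫ x, |f x| ^ 3 ∂μ ≤ √(∫ x, f x ^ 2 ∂μ) * √(∫ x, f x ^ 4 ∂μ) := by
  have h := integral_abs_mul_abs_le (hf.mono_exponent (by norm_num)) (memLp_two_mul hf hf)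
  convert! h using 4 with x
  · rw [abs_mul]; ring
  · ext x; ring

/-- The linear form `∑ l, b l * X l` in a finite family of random variables. -/
def linSum {Ω ι : Type*} [Fintype ι] (b : ι → ℝ) (X : ι → Ω → ℝ) (ω : Ω) : ℝ :=
  ∑ l, b l * X l ω

/-- The quadratic form `∑ k, ∑ l, B k l * X k * X l` in a finite family of random variables. The
index type is arbitrary, unlike in `quadForm`, so that the variables may be indexed by pairs. -/
def quadSum {Ω ι : Type*} [Fintype ι] (B : ι → ι → ℝ) (X : ι → Ω → ℝ) (ω : Ω) : ℝ :=
  ∑ k, ∑ l, B k l * (X k ω * X l ω)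

theorem linSum_sq {Ω ι : Type*} [Fintype ι] (b : ι → ℝ) (X : ι → Ω → ℝ) (ω : Ω) :
    linSum b X ω ^ 2 = quadSum (fun k l => b k * b l) X ω := by
  simp only [linSum, quadSum, sq, Finset.sum_mul_sum, mul_mul_mul_comm]

/-- A family of independent real random variables with mean `0`, variance `1` and finite fourth
moment. -/
structure IsStdSample {Ω ι : Type*} [MeasurableSpace Ω] (P : Measure Ω) (X : ι → Ω → ℝ) :
    Prop where
  memLp : ∀ i, MemLp (X i) 4 P
  indep : iIndepFun X P
  mean : ∀ i, ∫ ω, X i ω ∂P = 0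
  var : ∀ i, ∫ ω, X i ω ^ 2 ∂P = 1

namespace IsStdSample

variable {Ω ι : Type*} [MeasurableSpace Ω] {P : Measure Ω} {X : ι → Ω → ℝ}

theorem aestronglyMeasurable (h : IsStdSample P X) (i : ι) : AEStronglyMeasurable (X i) P :=
  (h.memLp i).aestronglyMeasurable

theorem integral_mul [DecidableEq ι] (h : IsStdSample P X) (k l : ι) :
    ∫ ω, X k ω * X l ω ∂P = if k = l then 1 else 0 := by
  split_ifs with hkl
  · simpa only [← hkl, ← sq] using h.var k
  · rw [(h.indep.indepFun hkl).integral_fun_mul_eq_mul_integral (h.aestronglyMeasurable k)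
      (h.aestronglyMeasurable l), h.mean k, zero_mul]

theorem integral_sq_mul_sq (h : IsStdSample P X) {k l : ι} (hkl : k ≠ l) :
    ∫ ω, X k ω ^ 2 * X l ω ^ 2 ∂P = 1 := by
  have h_indep : IndepFun (fun ω => X k ω ^ 2) (fun ω => X l ω ^ 2) P :=
    (h.indep.indepFun hkl).comp (measurable_id.pow_const 2) (measurable_id.pow_const 2)
  rw [h_indep.integral_fun_mul_eq_mul_integral ((h.aestronglyMeasurable k).pow 2)
    ((h.aestronglyMeasurable l).pow 2), h.var k, h.var l, mul_one]

theorem integral_mul_mul_mul_eq_zero (h : IsStdSample P X) {a b c d : ι} (hb : a ≠ b)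
    (hc : a ≠ c) (hd : a ≠ d) : ∫ ω, X a ω * (X b ω * X c ω * X d ω) ∂P = 0 := by
  classical
  have h_fst : Measurable fun g : ({a} : Finset ι) → ℝ => g ⟨a, by simp⟩ := by fun_prop
  have h_snd : Measurable fun g : ({b, c, d} : Finset ι) → ℝ =>
      g ⟨b, by simp⟩ * g ⟨c, by simp⟩ * g ⟨d, by simp⟩ := by fun_prop
  have h_indep : IndepFun (X a) (fun ω => X b ω * X c ω * X d ω) P :=
    (h.indep.indepFun_finset₀ {a} {b, c, d} (by simp [hb, hc, hd])
      fun i => (h.aestronglyMeasurable i).aemeasurable).comp h_fst h_snd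
  rw [h_indep.integral_fun_mul_eq_mul_integral (h.aestronglyMeasurable a)
    (((h.aestronglyMeasurable b).mul (h.aestronglyMeasurable c)).mul (h.aestronglyMeasurable d)),
    h.mean a, zero_mul]

theorem integral_mul_self_mul_mul [DecidableEq ι] (h : IsStdSample P X) (k i j : ι) :
    ∫ ω, X k ω * X k ω * (X i ω * X j ω) ∂P
      = if i = j then if k = i then ∫ ω, X k ω ^ 4 ∂P else 1 else 0 := by
  split_ifs with hij hki
  · subst hij hki
    congr with ω; ring
  · subst hij
    simpa only [sq] using h.integral_sq_mul_sq hki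
  · obtain hik | hjk : i ≠ k ∨ j ≠ k := by grind
    · rw [← h.integral_mul_mul_mul_eq_zero hik hik hij]
      congr with ω; ring
    · rw [← h.integral_mul_mul_mul_eq_zero hjk hjk (Ne.symm hij)]
      congr with ω; ring

theorem integral_mul_mul_mul_of_ne [DecidableEq ι] (h : IsStdSample P X) {k l : ι} (hkl : k ≠ l)
    (i j : ι) : ∫ ω, X k ω * X l ω * (X i ω * X j ω) ∂P
      = (if k = i ∧ l = j then 1 else 0) + (if k = j ∧ l = i then 1 else 0) := by
  by_cases hk : k ≠ i ∧ k ≠ j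
  · simpa only [hk.1, hk.2, false_and, if_false, add_zero, mul_assoc]
      using h.integral_mul_mul_mul_eq_zero hkl hk.1 hk.2
  by_cases hl : l ≠ i ∧ l ≠ j
  · simpa only [hl.1, hl.2, and_false, if_false, add_zero, mul_assoc, mul_left_comm (X l _)]
      using h.integral_mul_mul_mul_eq_zero hkl.symm hl.1 hl.2
  obtain ⟨rfl, rfl⟩ | ⟨rfl, rfl⟩ : (k = i ∧ l = j) ∨ (k = j ∧ l = i) := by grind
  · simpa [hkl, sq, mul_mul_mul_comm] using h.integral_sq_mul_sq hkl
  · simpa [hkl, sq, mul_mul_mul_comm, mul_comm (X l _) (X k _)] using h.integral_sq_mul_sq hkl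

theorem integral_abs_pow_three_le_sqrt [IsProbabilityMeasure P] (h : IsStdSample P X) (k : ι) :
    ∫ ω, |X k ω| ^ 3 ∂P ≤ √(∫ ω, X k ω ^ 4 ∂P) := by
  simpa [h.var k] using integral_abs_pow_three_le (h.memLp k)

theorem one_le_integral_pow_four [IsProbabilityMeasure P] (h : IsStdSample P X) (i : ι) :
    1 ≤ ∫ ω, X i ω ^ 4 ∂P := by
  have h_cs := integral_abs_le_sqrt (memLp_two_mul (h.memLp i) (h.memLp i))
  simp only [← sq, ← pow_mul, abs_sq, h.var i] at h_cs
  simpa using h_cs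

variable [Fintype ι]

theorem memLp_linSum (h : IsStdSample P X) (b : ι → ℝ) : MemLp (linSum b X) 4 P :=
  memLp_finsetSum _ fun l _ => (h.memLp l).const_mul (b l)

theorem memLp_quadSum (h : IsStdSample P X) (B : ι → ι → ℝ) : MemLp (quadSum B X) 2 P :=
  memLp_finsetSum _ fun k _ => memLp_finsetSum _ fun l _ =>
    (memLp_two_mul (h.memLp k) (h.memLp l)).const_mul (B k l)

theorem integral_mul_quadSum (h : IsStdSample P X) {g : Ω → ℝ} (hg : MemLp g 2 P)
    (B : ι → ι → ℝ) : ∫ ω, g ω * quadSum B X ω ∂P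
      = ∑ k, ∑ l, B k l * ∫ ω, g ω * (X k ω * X l ω) ∂P := by
  have h_int : ∀ k l, Integrable (fun ω => B k l * (g ω * (X k ω * X l ω))) P := fun k l =>
    (hg.integrable_mul (memLp_two_mul (h.memLp k) (h.memLp l))).const_mul (B k l)
  simp only [quadSum, Finset.mul_sum, mul_left_comm (g _) (B _ _)]
  rw [integral_finsetSum _ fun k _ => integrable_finsetSum _ fun l _ => h_int k l]
  refine Finset.sum_congr rfl fun k _ => ?_
  rw [integral_finsetSum _ fun l _ => h_int k l]
  simp only [integral_const_mul]

theorem integral_quadSum [IsProbabilityMeasure P] (h : IsStdSample P X) (B : ι → ι → ℝ) :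
    ∫ ω, quadSum B X ω ∂P = ∑ k, B k k := by
  classical
  simpa [h.integral_mul] using h.integral_mul_quadSum (memLp_const (1 : ℝ)) B

theorem integral_mul_mul_quadSum [DecidableEq ι] (h : IsStdSample P X) (B : ι → ι → ℝ)
    (k l : ι) : ∫ ω, X k ω * X l ω * quadSum B X ω ∂P
      = (if k = l then ∑ i, B i i + (∫ ω, X k ω ^ 4 ∂P - 3) * B k k else 0)
        + (B k l + B l k) := by
  rw [h.integral_mul_quadSum (memLp_two_mul (h.memLp k) (h.memLp l))]
  split_ifs with hkl
  · subst hkl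
    have h_diag : ∀ i, B i i * (if k = i then ∫ ω, X k ω ^ 4 ∂P else 1)
        = B i i + if k = i then (∫ ω, X k ω ^ 4 ∂P - 1) * B k k else 0 := fun i => by
      split_ifs with hki
      · subst hki; ring
      · ring
    simp only [h.integral_mul_self_mul_mul, mul_ite, mul_zero, Finset.sum_ite_eq,
      Finset.mem_univ, if_true]
    simp only [← mul_ite, h_diag, Finset.sum_add_distrib, Finset.sum_ite_eq, Finset.mem_univ,
      if_true]
    ring
  · simp [h.integral_mul_mul_mul_of_ne hkl, mul_add, Finset.sum_add_distrib, ite_and]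

theorem integral_quadSum_sq (h : IsStdSample P X) (B : ι → ι → ℝ) :
    ∫ ω, quadSum B X ω ^ 2 ∂P
      = (∑ k, B k k) ^ 2 + ∑ k, (∫ ω, X k ω ^ 4 ∂P - 3) * B k k ^ 2
        + (∑ k, ∑ l, B k l ^ 2 + ∑ k, ∑ l, B k l * B l k) := by
  classical
  have h_term : ∀ k l, ∫ ω, quadSum B X ω * (X k ω * X l ω) ∂P
      = (if k = l then ∑ i, B i i + (∫ ω, X k ω ^ 4 ∂P - 3) * B k k else 0)
        + (B k l + B l k) := fun k l => by
    rw [← h.integral_mul_mul_quadSum]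
    simp only [mul_comm]
  simp only [sq, h.integral_mul_quadSum (h.memLp_quadSum B), h_term, mul_add,
    Finset.sum_add_distrib, mul_ite, mul_zero, Finset.sum_ite_eq, Finset.mem_univ, if_true,
    ← Finset.sum_mul, mul_left_comm (B _ _) (_ - _)]

variable {m : NNReal}

theorem integral_linSum_pow_four_le (h : IsStdSample P X)
    (hm : ∀ i, ∫ ω, X i ω ^ 4 ∂P ≤ m) (b : ι → ℝ) :
    ∫ ω, linSum b X ω ^ 4 ∂P ≤ (m + 3) * (∑ l, b l ^ 2) ^ 2 := by
  have h_cross : ∑ k, ∑ l, (b k * b l) ^ 2 = (∑ l, b l ^ 2) ^ 2 := by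
    simp only [sq, Finset.sum_mul_sum, mul_mul_mul_comm]
  have h_diag : ∑ k, (∫ ω, X k ω ^ 4 ∂P - 3) * (b k ^ 2) ^ 2 ≤ m * (∑ l, b l ^ 2) ^ 2 :=
    calc _ ≤ ∑ k, m * (b k ^ 2) ^ 2 := by gcongr with k; linarith [hm k]
      _ ≤ m * (∑ l, b l ^ 2) ^ 2 := by
        rw [← Finset.mul_sum]
        gcongr
        exact Finset.sum_sq_le_sq_sum_of_nonneg fun l _ => sq_nonneg _
  calc ∫ ω, linSum b X ω ^ 4 ∂P
      = ∫ ω, quadSum (fun k l => b k * b l) X ω ^ 2 ∂P := by simp only [← linSum_sq, ← pow_mul]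
    _ = (∑ l, b l ^ 2) ^ 2 + ∑ k, (∫ ω, X k ω ^ 4 ∂P - 3) * (b k ^ 2) ^ 2
        + ((∑ l, b l ^ 2) ^ 2 + (∑ l, b l ^ 2) ^ 2) := by
      rw [h.integral_quadSum_sq]
      simp only [mul_comm (b _) (b _), ← sq, h_cross]
    _ ≤ _ := by linarith

variable [IsProbabilityMeasure P]

theorem integral_linSum_sq (h : IsStdSample P X) (b : ι → ℝ) :
    ∫ ω, linSum b X ω ^ 2 ∂P = ∑ l, b l ^ 2 := by
  simp only [linSum_sq, h.integral_quadSum, ← sq]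

theorem integral_abs_linSum_pow_three_le (h : IsStdSample P X)
    (hm : ∀ i, ∫ ω, X i ω ^ 4 ∂P ≤ m) (b : ι → ℝ) :
    ∫ ω, |linSum b X ω| ^ 3 ∂P ≤ √((m : ℝ) + 3) * (√(∑ l, b l ^ 2) * ∑ l, b l ^ 2) := by
  have hs : 0 ≤ ∑ l, b l ^ 2 := Finset.sum_nonneg fun l _ => sq_nonneg _
  calc _ ≤ √(∫ ω, linSum b X ω ^ 2 ∂P) * √(∫ ω, linSum b X ω ^ 4 ∂P) :=
        integral_abs_pow_three_le (h.memLp_linSum b)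
    _ ≤ √(∑ l, b l ^ 2) * √(((m : ℝ) + 3) * (∑ l, b l ^ 2) ^ 2) := by
        rw [h.integral_linSum_sq]
        gcongr
        exact h.integral_linSum_pow_four_le hm b
    _ = _ := by rw [Real.sqrt_mul (by positivity), Real.sqrt_sq hs, mul_left_comm]

end IsStdSample

end Moments

section QuadraticForms

theorem quadSum_eq_sum_mul_linSum {Ω ι : Type*} [Fintype ι] (A : ι → ι → ℝ) (X : ι → Ω → ℝ)
    (ω : Ω) : quadSum A X ω = ∑ k, X k ω * linSum (A k) X ω := by
  simp only [quadSum, linSum, Finset.mul_sum, mul_left_comm]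

theorem sum_linSum_sq {Ω ι : Type*} [Fintype ι] (A : ι → ι → ℝ) (X : ι → Ω → ℝ) (ω : Ω) :
    ∑ k, linSum (A k) X ω ^ 2 = quadSum (fun l p => ∑ k, A k l * A k p) X ω := by
  simp only [linSum_sq, quadSum, Finset.sum_mul]
  rw [Finset.sum_comm]
  exact Finset.sum_congr rfl fun l _ => Finset.sum_comm

/-- The part of the quadratic form `quadSum A X` that does not involve the variable `X k`. -/
def quadSumErase {Ω ι : Type*} [Fintype ι] [DecidableEq ι] (A : ι → ι → ℝ) (X : ι → Ω → ℝ) (k : ι)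
    (ω : Ω) : ℝ :=
  ∑ i ∈ Finset.univ.erase k, ∑ j ∈ Finset.univ.erase k, A i j * (X i ω * X j ω)

theorem linSum_eq_sum_erase {Ω ι : Type*} [Fintype ι] [DecidableEq ι] {b : ι → ℝ} {k : ι}
    (hb : b k = 0) (X : ι → Ω → ℝ) (ω : Ω) :
    linSum b X ω = ∑ l ∈ Finset.univ.erase k, b l * X l ω := by
  rw [linSum, ← Finset.add_sum_erase _ _ (Finset.mem_univ k), hb, zero_mul, zero_add]

theorem quadSum_eq_quadSumErase_add {Ω ι : Type*} [Fintype ι] [DecidableEq ι] {A : ι → ι → ℝ}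
    (hA : ∀ k l, A k l = A l k) {k : ι} (hk : A k k = 0) (X : ι → Ω → ℝ) (ω : Ω) :
    quadSum A X ω = quadSumErase A X k ω + X k ω * (2 * linSum (A k) X ω) := by
  have h_row (i : ι) : ∑ j, A i j * (X i ω * X j ω) = X k ω * (A k i * X i ω)
      + ∑ j ∈ Finset.univ.erase k, A i j * (X i ω * X j ω) := by
    rw [← Finset.add_sum_erase _ _ (Finset.mem_univ k), hA i k]
    ring
  have h_row_k : ∑ j ∈ Finset.univ.erase k, A k j * (X k ω * X j ω)
      = X k ω * linSum (A k) X ω := by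
    simp only [linSum_eq_sum_erase hk, Finset.mul_sum, mul_left_comm]
  calc quadSum A X ω
      = X k ω * linSum (A k) X ω + ∑ i, ∑ j ∈ Finset.univ.erase k, A i j * (X i ω * X j ω) := by
        simp only [quadSum, h_row, Finset.sum_add_distrib, ← Finset.mul_sum, linSum]
    _ = _ := by
        rw [← Finset.add_sum_erase _ _ (Finset.mem_univ k), h_row_k, quadSumErase]
        ring

namespace IsStdSample

variable {Ω ι : Type*} [MeasurableSpace Ω] {P : Measure Ω} {X : ι → Ω → ℝ} [Fintype ι]

theorem indepFun_linSum_quadSumErase [DecidableEq ι] (h : IsStdSample P X) {A : ι → ι → ℝ} {k : ι}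
    (hk : A k k = 0) :
    IndepFun (X k) (fun ω => (2 * linSum (A k) X ω, quadSumErase A X k ω)) P := by
  have h_fst : Measurable fun g : ({k} : Finset ι) → ℝ => g ⟨k, by simp⟩ := by fun_prop
  have h_snd : Measurable fun g : ↥(Finset.univ.erase k) → ℝ =>
      (2 * ∑ l : ↥(Finset.univ.erase k), A k l * g l,
        ∑ i : ↥(Finset.univ.erase k), ∑ j : ↥(Finset.univ.erase k), A i j * (g i * g j)) := by
    fun_prop
  have h_indep := (h.indep.indepFun_finset₀ {k} (Finset.univ.erase k) (by simp)
    fun i => (h.aestronglyMeasurable i).aemeasurable).comp h_fst h_snd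
  simp only [linSum_eq_sum_erase hk, quadSumErase, ← Finset.sum_coe_sort (Finset.univ.erase k)]
  exact h_indep

theorem aemeasurable_quadSumErase [DecidableEq ι] (h : IsStdSample P X) (A : ι → ι → ℝ) (k : ι) :
    AEMeasurable (quadSumErase A X k) P :=
  Finset.aemeasurable_fun_sum _ fun i _ => Finset.aemeasurable_fun_sum _ fun j _ =>
    ((h.aestronglyMeasurable i).mul (h.aestronglyMeasurable j)).aemeasurable.const_mul (A i j)

variable {A : ι → ι → ℝ} {m : NNReal}

theorem sum_sq_eq_half (h : IsStdSample P X) (hA : ∀ k l, A k l = A l k) (hk : ∀ k, A k k = 0)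
    (hQ : ∫ ω, quadSum A X ω ^ 2 ∂P = 1) : ∑ k, ∑ l, A k l ^ 2 = 1 / 2 := by
  have h_symm : ∀ k l, A k l * A l k = A k l ^ 2 := fun k l => by rw [hA l k, sq]
  simp only [h.integral_quadSum_sq, hk, h_symm, Finset.sum_const_zero, ne_eq, OfNat.ofNat_ne_zero,
    not_false_eq_true, zero_pow, mul_zero, zero_add] at hQ
  linarith

variable [IsProbabilityMeasure P]

theorem integral_one_sub_two_mul_quadSum_sq (h : IsStdSample P X) {B : ι → ι → ℝ}
    (hB : ∀ l p, B l p = B p l) (h_trace : ∑ l, B l l = 1 / 2) :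
    ∫ ω, (1 - 2 * quadSum B X ω) ^ 2 ∂P
      = 4 * (∑ l, (∫ ω, X l ω ^ 4 ∂P - 3) * B l l ^ 2 + 2 * ∑ l, ∑ p, B l p ^ 2) := by
  have h_symm : ∀ l p, B l p * B p l = B l p ^ 2 := fun l p => by rw [hB p l, sq]
  have h_expand : ∀ ω, (1 - 2 * quadSum B X ω) ^ 2
      = 1 - 4 * quadSum B X ω + 4 * quadSum B X ω ^ 2 := fun ω => by ring
  have h_sq := (h.memLp_quadSum B).integrable_sq
  have h_lin := (h.memLp_quadSum B).integrable (by norm_num)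
  have h_sub : Integrable (fun ω => 1 - 4 * quadSum B X ω) P :=
    (integrable_const 1).sub (h_lin.const_mul 4)
  simp only [h_expand]
  rw [integral_add h_sub (h_sq.const_mul 4), integral_sub (integrable_const 1)
    (h_lin.const_mul 4), integral_const_mul, integral_const_mul, h.integral_quadSum,
    h.integral_quadSum_sq, h_trace]
  simp only [h_symm, integral_const, probReal_univ, smul_eq_mul]
  ring

theorem integral_abs_one_sub_sum_linSum_sq_le (h : IsStdSample P X)
    (hm : ∀ i, ∫ ω, X i ω ^ 4 ∂P ≤ m) (hA : ∑ k, ∑ l, A k l ^ 2 = 1 / 2) :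
    ∫ ω, |1 - 2 * ∑ k, linSum (A k) X ω ^ 2| ∂P ≤
      2 * √(m * ∑ l, (∑ k, A k l ^ 2) ^ 2 + 2 * ∑ l, ∑ p, (∑ k, A k l * A k p) ^ 2) := by
  set B : ι → ι → ℝ := fun l p => ∑ k, A k l * A k p with hB
  have h_diag : ∀ l, B l l = ∑ k, A k l ^ 2 := fun l => by simp only [hB, sq]
  have h_symm : ∀ l p, B l p = B p l := fun l p => by simp only [hB, mul_comm]
  have h_trace : ∑ l, B l l = 1 / 2 := by simp only [h_diag]; rw [Finset.sum_comm, hA]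
  have h_excess : ∑ l, (∫ ω, X l ω ^ 4 ∂P - 3) * B l l ^ 2 ≤ m * ∑ l, B l l ^ 2 := by
    rw [Finset.mul_sum]
    gcongr with l
    linarith [hm l]
  simp only [sum_linSum_sq, ← h_diag]
  calc ∫ ω, |1 - 2 * quadSum B X ω| ∂P ≤ √(∫ ω, (1 - 2 * quadSum B X ω) ^ 2 ∂P) :=
        integral_abs_le_sqrt ((memLp_const 1).sub ((h.memLp_quadSum B).const_mul 2))
    _ ≤ √(2 ^ 2 * (m * ∑ l, B l l ^ 2 + 2 * ∑ l, ∑ p, B l p ^ 2)) := by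
        refine Real.sqrt_le_sqrt ?_
        rw [h.integral_one_sub_two_mul_quadSum_sq h_symm h_trace]
        linarith
    _ = _ := by rw [Real.sqrt_mul (by positivity), Real.sqrt_sq zero_le_two]

theorem sum_integral_abs_pow_three_mul_le (h : IsStdSample P X)
    (hm : ∀ i, ∫ ω, X i ω ^ 4 ∂P ≤ m) (hA : ∑ k, ∑ l, A k l ^ 2 = 1 / 2) :
    ∑ k, 16 / 3 * ((∫ ω, |X k ω| ^ 3 ∂P) * ∫ ω, |linSum (A k) X ω| ^ 3 ∂P)
      ≤ 4 * √((3 * m + m ^ 2) * ∑ k, (∑ l, A k l ^ 2) ^ 2) := by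
  set s : ι → ℝ := fun k => ∑ l, A k l ^ 2
  have hs : ∀ k, 0 ≤ s k := fun k => Finset.sum_nonneg fun l _ => sq_nonneg _
  have h_cs : ∑ k, √(s k) * s k ≤ √(1 / 2) * √(∑ k, s k ^ 2) := by
    rw [← hA]
    simpa only [Real.sqrt_sq (hs _)]
      using Real.sum_sqrt_mul_sqrt_le Finset.univ hs fun k => sq_nonneg (s k)
  calc ∑ k, 16 / 3 * ((∫ ω, |X k ω| ^ 3 ∂P) * ∫ ω, |linSum (A k) X ω| ^ 3 ∂P)
      ≤ ∑ k, 16 / 3 * (√m * (√((m : ℝ) + 3) * (√(s k) * s k))) := by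
        gcongr with k
        · exact (h.integral_abs_pow_three_le_sqrt k).trans (Real.sqrt_le_sqrt (hm k))
        · exact h.integral_abs_linSum_pow_three_le hm (A k)
    _ = 16 / 3 * √m * √((m : ℝ) + 3) * ∑ k, √(s k) * s k := by
        rw [Finset.mul_sum]
        exact Finset.sum_congr rfl fun k _ => by ring
    _ ≤ 16 / 3 * √m * √((m : ℝ) + 3) * (√(1 / 2) * √(∑ k, s k ^ 2)) := by gcongr
    _ = 16 / 3 * √(1 / 2) * √((3 * m + m ^ 2) * ∑ k, s k ^ 2) := by
        rw [show (3 * m + m ^ 2 : ℝ) = m * (m + 3) by ring, Real.sqrt_mul (by positivity),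
          Real.sqrt_mul (by positivity)]
        ring
    _ ≤ _ := by
        gcongr
        have : √(1 / 2 : ℝ) ≤ 3 / 4 := Real.sqrt_le_iff.2 ⟨by norm_num, by norm_num⟩
        linarith

end IsStdSample

end QuadraticForms

section NormalApproximation

namespace IsStdSample

variable {Ω ι : Type*} [MeasurableSpace Ω] {P : Measure Ω} {X : ι → Ω → ℝ} [Fintype ι]
  {A : ι → ι → ℝ} {f : ℝ → ℝ} {m : NNReal}

theorem aestronglyMeasurable_deriv_comp_quadSum (h : IsStdSample P X) (hf : IsSteinTest f) :
    AEStronglyMeasurable (fun ω => deriv f (quadSum A X ω)) P :=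
  hf.lipschitz_deriv.continuous.comp_aestronglyMeasurable (h.memLp_quadSum A).aestronglyMeasurable

variable [IsProbabilityMeasure P]

theorem integrable_mul_linSum_mul_sub (h : IsStdSample P X) (hf : IsSteinTest f) (k : ι) :
    Integrable (fun ω => X k ω * linSum (A k) X ω * f (quadSum A X ω)
      - 2 * linSum (A k) X ω ^ 2 * deriv f (quadSum A X ω)) P := by
  have h_fQ := memLp_comp_of_lipschitzWith hf.lipschitz (h.memLp_quadSum A)
  have hV := h.memLp_linSum (A k)
  have h_sq : Integrable (fun ω => 2 * linSum (A k) X ω ^ 2) P :=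
    (hV.mono_exponent (by norm_num)).integrable_sq.const_mul 2
  exact ((memLp_two_mul (h.memLp k) hV).integrable_mul h_fQ).sub
    (h_sq.mul_bdd (h.aestronglyMeasurable_deriv_comp_quadSum hf)
      (.of_forall fun ω => norm_deriv_le_of_lipschitz hf.lipschitz))

theorem abs_integral_mul_linSum_mul_sub_le (h : IsStdSample P X) (hA : ∀ k l, A k l = A l k) {k : ι}
    (hk : A k k = 0) (hf : IsSteinTest f) :
    |∫ ω, (X k ω * linSum (A k) X ω * f (quadSum A X ω)
        - 2 * linSum (A k) X ω ^ 2 * deriv f (quadSum A X ω)) ∂P|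
      ≤ 16 / 3 * ((∫ ω, |X k ω| ^ 3 ∂P) * ∫ ω, |linSum (A k) X ω| ^ 3 ∂P) := by
  classical
  have h_bound := abs_integral_mul_comp_add_sub_le ((h.memLp k).mono_exponent (by norm_num))
    (((h.memLp_linSum (A k)).mono_exponent (by norm_num)).const_mul 2)
    (h.aemeasurable_quadSumErase A k) (h.indepFun_linSum_quadSumErase hk) (h.mean k) (h.var k)
    hf.differentiable hf.lipschitz_deriv
  simp only [← quadSum_eq_quadSumErase_add hA hk] at h_bound
  have h_left : ∀ ω, X k ω * linSum (A k) X ω * f (quadSum A X ω)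
        - 2 * linSum (A k) X ω ^ 2 * deriv f (quadSum A X ω)
      = 1 / 2 * (X k ω * (2 * linSum (A k) X ω) * f (quadSum A X ω)
        - (2 * linSum (A k) X ω) ^ 2 * deriv f (quadSum A X ω)) := fun ω => by ring
  have h_right : ∫ ω, |2 * linSum (A k) X ω| ^ 3 ∂P = 8 * ∫ ω, |linSum (A k) X ω| ^ 3 ∂P := by
    rw [← integral_const_mul]
    congr with ω
    rw [abs_mul, mul_pow]
    norm_num
  rw [h_right, NNReal.coe_ofNat] at h_bound
  simp only [h_left]
  rw [integral_const_mul, abs_mul, abs_of_pos one_half_pos]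
  linarith

theorem abs_integral_deriv_sub_mul_le (h : IsStdSample P X) (hA : ∀ k l, A k l = A l k)
    (hk : ∀ k, A k k = 0) (hf : IsSteinTest f) :
    |∫ ω, (deriv f (quadSum A X ω) - quadSum A X ω * f (quadSum A X ω)) ∂P|
      ≤ ∫ ω, |1 - 2 * ∑ k, linSum (A k) X ω ^ 2| ∂P
        + ∑ k, 16 / 3 * ((∫ ω, |X k ω| ^ 3 ∂P) * ∫ ω, |linSum (A k) X ω| ^ 3 ∂P) := by
  have h_split : ∀ ω, deriv f (quadSum A X ω) - quadSum A X ω * f (quadSum A X ω)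
      = (1 - 2 * ∑ k, linSum (A k) X ω ^ 2) * deriv f (quadSum A X ω)
        - ∑ k, (X k ω * linSum (A k) X ω * f (quadSum A X ω)
          - 2 * linSum (A k) X ω ^ 2 * deriv f (quadSum A X ω)) := fun ω => by
    rw [Finset.sum_sub_distrib, ← Finset.sum_mul, ← Finset.sum_mul, ← quadSum_eq_sum_mul_linSum,
      ← Finset.mul_sum]
    ring
  have h_int_var : Integrable (fun ω => 1 - 2 * ∑ k, linSum (A k) X ω ^ 2) P := by
    simp only [sum_linSum_sq]
    exact (integrable_const 1).sub (((h.memLp_quadSum _).integrable (by norm_num)).const_mul 2)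
  have h_deriv_le : ∀ x, ‖deriv f x‖ ≤ 1 := fun x => norm_deriv_le_of_lipschitz hf.lipschitz
  have h_int := h.integrable_mul_linSum_mul_sub (A := A) hf
  have h_var : |∫ ω, (1 - 2 * ∑ k, linSum (A k) X ω ^ 2) * deriv f (quadSum A X ω) ∂P|
      ≤ ∫ ω, |1 - 2 * ∑ k, linSum (A k) X ω ^ 2| ∂P := by
    rw [← Real.norm_eq_abs]
    refine norm_integral_le_of_norm_le h_int_var.abs (.of_forall fun ω => ?_)
    rw [norm_mul]
    exact mul_le_of_le_one_right (norm_nonneg _) (h_deriv_le _)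
  have h_sum : |∑ k, ∫ ω, (X k ω * linSum (A k) X ω * f (quadSum A X ω)
          - 2 * linSum (A k) X ω ^ 2 * deriv f (quadSum A X ω)) ∂P|
      ≤ ∑ k, 16 / 3 * ((∫ ω, |X k ω| ^ 3 ∂P) * ∫ ω, |linSum (A k) X ω| ^ 3 ∂P) :=
    (Finset.abs_sum_le_sum_abs _ _).trans
      (Finset.sum_le_sum fun k _ => h.abs_integral_mul_linSum_mul_sub_le hA (hk k) hf)
  simp only [h_split]
  rw [integral_sub (h_int_var.mul_bdd (h.aestronglyMeasurable_deriv_comp_quadSum hf)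
      (.of_forall fun ω => h_deriv_le _)) (integrable_finsetSum _ fun k _ => h_int k),
    integral_finsetSum _ fun k _ => h_int k]
  exact (abs_sub _ _).trans (add_le_add h_var h_sum)

theorem wassersteinDist_quadSum_le (h : IsStdSample P X) (hm : ∀ i, ∫ ω, X i ω ^ 4 ∂P ≤ m)
    (hA : ∀ k l, A k l = A l k) (hk : ∀ k, A k k = 0) (hA_sum : ∑ k, ∑ l, A k l ^ 2 = 1 / 2) :
    wassersteinDist (P.map (quadSum A X)) (gaussianReal 0 1) ≤ ENNReal.ofReal
      (2 * √(m * ∑ l, (∑ k, A k l ^ 2) ^ 2 + 2 * ∑ l, ∑ p, (∑ k, A k l * A k p) ^ 2)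
      + 4 * √((3 * m + m ^ 2) * ∑ k, (∑ l, A k l ^ 2) ^ 2)) := by
  have hQ := (h.memLp_quadSum A).aestronglyMeasurable.aemeasurable
  have := Measure.isProbabilityMeasure_map hQ
  refine wassersteinDist_gaussianReal_le ?_ fun f hf => ?_
  · exact (integrable_map_measure aestronglyMeasurable_id hQ).2
      ((h.memLp_quadSum A).integrable (by norm_num))
  · have h_cont := hf.differentiable.continuous
    have h_cont_deriv := hf.lipschitz_deriv.continuous
    rw [integral_map hQ (Continuous.aestronglyMeasurable (by fun_prop))]
    exact (h.abs_integral_deriv_sub_mul_le hA hk hf).trans (add_le_add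
      (h.integral_abs_one_sub_sum_linSum_sq_le hm hA_sum)
      (h.sum_integral_abs_pow_three_mul_le hm hA_sum))

end IsStdSample

end NormalApproximation

section FourthMoment

theorem integral_pow_four_le_of_fourthMoment_le {Ω : Type*} [MeasurableSpace Ω] {P : Measure Ω}
    {Y : Ω → ℝ} {m : NNReal} (hm : fourthMoment P Y ≤ m) : ∫ ω, Y ω ^ 4 ∂P ≤ m := by
  have h_norm : ∀ ω, ‖Y ω ^ 4‖ = Y ω ^ 4 := fun ω => Real.norm_of_nonneg (by positivity)
  have h_le := norm_integral_le_lintegral_norm (μ := P) fun ω => Y ω ^ 4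
  simp only [h_norm] at h_le
  exact (le_abs_self _).trans (h_le.trans (ENNReal.toReal_mono ENNReal.coe_ne_top hm))

theorem memLp_four_of_fourthMoment_ne_top {Ω : Type*} [MeasurableSpace Ω] {P : Measure Ω}
    {Y : Ω → ℝ} (hY : AEMeasurable Y P) (hm : fourthMoment P Y ≠ ∞) : MemLp Y 4 P := by
  refine ⟨hY.aestronglyMeasurable, (eLpNorm_lt_top_iff_lintegral_rpow_enorm_lt_top (by norm_num)
    (by norm_num)).2 (lt_of_eq_of_lt (lintegral_congr fun ω => ?_) hm.lt_top)⟩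
  rw [ENNReal.toReal_ofNat, ENNReal.rpow_ofNat, Real.enorm_eq_ofReal_abs,
    ← ENNReal.ofReal_pow (abs_nonneg _), Even.pow_abs (by decide)]

theorem fourthMoment_congr {Ω : Type*} [MeasurableSpace Ω] {P : Measure Ω} {Y Z : Ω → ℝ}
    (h : IdentDistrib Y Z P P) : fourthMoment P Y = fourthMoment P Z :=
  (h.comp (u := fun x : ℝ => ENNReal.ofReal (x ^ 4)) (by fun_prop)).lintegral_eq

theorem isStdSample_comp {Ω ι : Type*} [MeasurableSpace Ω] {P : Measure Ω} {X : ℕ → Ω → ℝ}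
    (hmeas : ∀ k, AEMeasurable (X k) P) (hindep : iIndepFun X P) (hmean : ∀ k, ∫ ω, X k ω ∂P = 0)
    (hvar : ∀ k, ∫ ω, X k ω ^ 2 ∂P = 1) (hm : ∀ k, fourthMoment P (X k) ≠ ∞) {g : ι → ℕ}
    (hg : g.Injective) : IsStdSample P fun i => X (g i) where
  memLp i := memLp_four_of_fourthMoment_ne_top (hmeas (g i)) (hm (g i))
  indep := hindep.precomp hg
  mean i := hmean (g i)
  var i := hvar (g i)

end FourthMoment

section QuadForm

variable {n : ℕ} {A : Matrix (Fin n) (Fin n) ℝ}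

theorem quadForm_eq_quadSum {Ω : Type*} (X : ℕ → Ω → ℝ) :
    quadForm A X = quadSum A (fun k : Fin n => X k) := by
  funext ω
  simp only [quadForm, quadSum, mul_assoc]

theorem ne_zero_of_integral_quadForm_sq {Ω : Type*} [MeasurableSpace Ω] {P : Measure Ω}
    {X : ℕ → Ω → ℝ} (hQ : ∫ ω, quadForm A X ω ^ 2 ∂P ≠ 0) : A ≠ 0 := by
  rintro rfl
  simp [quadForm] at hQ

theorem sum_sq_pos {ι : Type*} [Fintype ι] {b : ι → ℝ} (hb : b ≠ 0) : 0 < ∑ l, b l ^ 2 := by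
  obtain ⟨l, hl⟩ := Function.ne_iff.1 hb
  exact Finset.sum_pos' (fun l _ => sq_nonneg _) ⟨l, Finset.mem_univ l, sq_pos_of_ne_zero hl⟩

theorem sum_row_sq_sq_pos (hA : A ≠ 0) : 0 < ∑ k, (∑ l, A k l ^ 2) ^ 2 := by
  obtain ⟨k, hk⟩ := Function.ne_iff.1 hA
  exact Finset.sum_pos' (fun k _ => sq_nonneg _)
    ⟨k, Finset.mem_univ k, pow_pos (sum_sq_pos hk) 2⟩

theorem sum_col_sq_sq_eq_sum_row_sq_sq (hA : A.IsSymm) :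
    ∑ l, (∑ k, A k l ^ 2) ^ 2 = ∑ k, (∑ l, A k l ^ 2) ^ 2 := by
  simp only [fun k l => hA.apply l k]

theorem sum_sq_le_maxRowSq (k : Fin n) : ∑ l, A k l ^ 2 ≤ maxRowSq A :=
  le_ciSup (f := fun k => ∑ l, A k l ^ 2) (Set.finite_range _).bddAbove k

theorem maxRowSq_pos (hA : A ≠ 0) : 0 < maxRowSq A := by
  obtain ⟨k, hk⟩ := Function.ne_iff.1 hA
  exact (sum_sq_pos hk).trans_le (sum_sq_le_maxRowSq k)

theorem sum_row_sq_sq_le_maxRowSq : ∑ k, (∑ l, A k l ^ 2) ^ 2 ≤ n * maxRowSq A ^ 2 := by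
  calc ∑ k, (∑ l, A k l ^ 2) ^ 2 ≤ ∑ _k : Fin n, maxRowSq A ^ 2 := by
        gcongr with k
        exact sum_sq_le_maxRowSq k
    _ = n * maxRowSq A ^ 2 := by simp

theorem ofReal_rpow_one_half {x : ℝ} (hx : 0 ≤ x) :
    ENNReal.ofReal x ^ (1 / 2 : ℝ) = ENNReal.ofReal √x := by
  rw [ENNReal.ofReal_rpow_of_nonneg hx (by norm_num), Real.sqrt_eq_rpow]

theorem ofReal_wassersteinBound (m : NNReal) {S T β : ℝ} (hS : 0 ≤ S) (hT : 0 ≤ T) (hβ : 0 ≤ β) :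
    ENNReal.ofReal (2 * √(m * S + 2 * β) + 4 * √((3 * m + m ^ 2) * T)) =
      2 * (m * ENNReal.ofReal S + 2 * ENNReal.ofReal β) ^ (1 / 2 : ℝ)
        + 4 * ((3 * m + m ^ 2) * ENNReal.ofReal T) ^ (1 / 2 : ℝ) := by
  have h_var : ENNReal.ofReal (m * S + 2 * β)
      = m * ENNReal.ofReal S + 2 * ENNReal.ofReal β := by
    rw [ENNReal.ofReal_add (by positivity) (by positivity), ENNReal.ofReal_mul m.coe_nonneg,
      ENNReal.ofReal_mul zero_le_two, ENNReal.ofReal_coe_nnreal, ENNReal.ofReal_ofNat]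
  have h_rem : ENNReal.ofReal ((3 * m + m ^ 2) * T) = (3 * m + m ^ 2) * ENNReal.ofReal T := by
    rw [ENNReal.ofReal_mul (by positivity), ENNReal.ofReal_add (by positivity) (by positivity),
      ENNReal.ofReal_mul (by norm_num), ENNReal.ofReal_pow m.coe_nonneg,
      ENNReal.ofReal_coe_nnreal, ENNReal.ofReal_ofNat]
  rw [ENNReal.ofReal_add (by positivity) (by positivity), ENNReal.ofReal_mul (by norm_num),
    ENNReal.ofReal_mul (by norm_num), ← ofReal_rpow_one_half (by positivity),
    ← ofReal_rpow_one_half (by positivity), h_var, h_rem, ENNReal.ofReal_ofNat,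
    ENNReal.ofReal_ofNat]

theorem wassersteinBound_le {m : ℝ≥0∞} {n M S T β : ℝ} (hn : 0 < n) (hM : 0 < M)
    (hS : S ≤ n * M ^ 2) (hT : T ≤ n * M ^ 2) :
    2 * (m * ENNReal.ofReal S + 2 * ENNReal.ofReal β) ^ (1 / 2 : ℝ)
        + 4 * ((3 * m + m ^ 2) * ENNReal.ofReal T) ^ (1 / 2 : ℝ) ≤
      ENNReal.ofReal (2 * √n * M) * ((m + ENNReal.ofReal (2 / (n * M ^ 2) * β)) ^ (1 / 2 : ℝ)
        + 2 * (3 * m + m ^ 2) ^ (1 / 2 : ℝ)) := by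
  set c := ENNReal.ofReal (n * M ^ 2)
  have h_coeff : ENNReal.ofReal (2 * √n * M) = 2 * c ^ (1 / 2 : ℝ) := by
    rw [ofReal_rpow_one_half (by positivity), Real.sqrt_mul hn.le, Real.sqrt_sq hM.le, mul_assoc,
      ENNReal.ofReal_mul zero_le_two, ENNReal.ofReal_ofNat]
  have h_gram : c * ENNReal.ofReal (2 / (n * M ^ 2) * β) = 2 * ENNReal.ofReal β := by
    rw [← ENNReal.ofReal_mul (by positivity),
      show n * M ^ 2 * (2 / (n * M ^ 2) * β) = 2 * β by field_simp,
      ENNReal.ofReal_mul zero_le_two, ENNReal.ofReal_ofNat]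
  have hS_c : ENNReal.ofReal S ≤ c := ENNReal.ofReal_le_ofReal hS
  have hT_c : ENNReal.ofReal T ≤ c := ENNReal.ofReal_le_ofReal hT
  calc _ ≤ 2 * (m * c + 2 * ENNReal.ofReal β) ^ (1 / 2 : ℝ)
        + 4 * ((3 * m + m ^ 2) * c) ^ (1 / 2 : ℝ) := by gcongr
    _ = 2 * c ^ (1 / 2 : ℝ) * ((m + ENNReal.ofReal (2 / (n * M ^ 2) * β)) ^ (1 / 2 : ℝ)
        + 2 * (3 * m + m ^ 2) ^ (1 / 2 : ℝ)) := by
      rw [← h_gram, mul_comm m c, ← mul_add, mul_comm _ c,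
        ENNReal.mul_rpow_of_nonneg _ _ (by norm_num), ENNReal.mul_rpow_of_nonneg _ _ (by norm_num)]
      ring
    _ = _ := by rw [h_coeff]

theorem wassersteinDist_quadForm_le {Ω : Type*} [MeasurableSpace Ω] {P : Measure Ω}
    [IsProbabilityMeasure P] {X : ℕ → Ω → ℝ} (hmeas : ∀ k, AEMeasurable (X k) P)
    (hindep : iIndepFun X P) (hmean : ∀ k, ∫ ω, X k ω ∂P = 0) (hvar : ∀ k, ∫ ω, X k ω ^ 2 ∂P = 1)
    {m : ℝ≥0∞} (hm : ∀ k, fourthMoment P (X k) ≤ m) (hA : A.IsSymm) (hd : ∀ k, A k k = 0)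
    (hQ : ∫ ω, quadForm A X ω ^ 2 ∂P = 1) :
    wassersteinDist (P.map (quadForm A X)) (gaussianReal 0 1) ≤
      2 * (m * ENNReal.ofReal (∑ l, (∑ k, A k l ^ 2) ^ 2)
          + 2 * ENNReal.ofReal (∑ l, ∑ p, (∑ k, A k l * A k p) ^ 2)) ^ (1 / 2 : ℝ)
        + 4 * ((3 * m + m ^ 2) * ENNReal.ofReal (∑ k, (∑ l, A k l ^ 2) ^ 2)) ^ (1 / 2 : ℝ) := by
  have hA_ne : A ≠ 0 := ne_zero_of_integral_quadForm_sq (hQ.trans_ne one_ne_zero)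
  obtain rfl | hm_top := eq_or_ne m ∞
  · rw [sum_col_sq_sq_eq_sum_row_sq_sq hA,
      ENNReal.top_mul (ENNReal.ofReal_pos.2 (sum_row_sq_sq_pos hA_ne)).ne', top_add,
      ENNReal.top_rpow_of_pos one_half_pos, ENNReal.mul_top two_ne_zero, top_add]
    exact le_top
  lift m to NNReal using hm_top
  have h_sample : IsStdSample P fun k : Fin n => X k := isStdSample_comp hmeas hindep hmean hvar
    (fun k => ((hm k).trans_lt ENNReal.coe_lt_top).ne) Fin.val_injective
  have hA_symm : ∀ k l, A k l = A l k := fun k l => hA.apply l k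
  rw [quadForm_eq_quadSum] at hQ ⊢
  rw [← ofReal_wassersteinBound m (by positivity) (by positivity) (by positivity)]
  exact h_sample.wassersteinDist_quadSum_le
    (fun k => integral_pow_four_le_of_fourthMoment_le (hm k)) hA_symm hd
    (h_sample.sum_sq_eq_half hA_symm hd hQ)

end QuadForm

section PairSum

/-- The coefficients of `(1/√n) ∑ k, X (2 * k) * X (2 * k + 1)` as a symmetric quadratic form; the
pair `(k, false)` stands for the index `2 * k` and `(k, true)` for `2 * k + 1`. -/
noncomputable def pairMatrix (n : ℕ) (p q : Fin n × Bool) : ℝ :=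
  if p.1 = q.1 ∧ p.2 ≠ q.2 then 1 / (2 * √(n : ℝ)) else 0

variable {n : ℕ}

theorem pairMatrix_symm (p q : Fin n × Bool) : pairMatrix n p q = pairMatrix n q p := by
  simp only [pairMatrix, eq_comm, ne_eq]

theorem pairMatrix_self (p : Fin n × Bool) : pairMatrix n p p = 0 := by simp [pairMatrix]

theorem sum_pairMatrix_mul (p q : Fin n × Bool) :
    ∑ k, pairMatrix n k p * pairMatrix n k q = if p = q then 1 / (4 * n : ℝ) else 0 := by
  have h_sq : (1 / (2 * √(n : ℝ))) * (1 / (2 * √(n : ℝ))) = 1 / (4 * n : ℝ) := by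
    rw [one_div_mul_one_div, mul_mul_mul_comm, Real.mul_self_sqrt n.cast_nonneg]
    norm_num
  obtain ⟨i, a⟩ := p
  obtain ⟨j, b⟩ := q
  rw [← h_sq, Fintype.sum_prod_type]
  cases a <;> cases b <;> simp [pairMatrix, ite_and, @eq_comm _ j i]

theorem sum_pairMatrix_sq (p : Fin n × Bool) : ∑ q, pairMatrix n p q ^ 2 = 1 / (4 * n : ℝ) := by
  simpa only [sq, pairMatrix_symm _ p, if_true] using sum_pairMatrix_mul p p

theorem quadSum_pairMatrix {Ω : Type*} (X : ℕ → Ω → ℝ) :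
    quadSum (pairMatrix n) (fun p => X (2 * p.1 + p.2.toNat)) =
      fun ω => 1 / √(n : ℝ) * ∑ k ∈ Finset.range n, X (2 * k) ω * X (2 * k + 1) ω := by
  funext ω
  rw [quadSum, Fintype.sum_prod_type, Finset.sum_range, Finset.mul_sum]
  refine Finset.sum_congr rfl fun i _ => ?_
  have h_entry : ∀ (j : Fin n) (a b : Bool), pairMatrix n (i, a) (j, b)
      = if i = j then if a = b then 0 else 1 / (2 * √(n : ℝ)) else 0 := fun j a b => by
    simp only [pairMatrix, ne_eq, ite_and, ite_not]
  simp only [Fintype.sum_prod_type, Fintype.sum_bool, h_entry, ite_mul, zero_mul,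
    Finset.sum_ite_eq, Finset.sum_add_distrib, Finset.mem_univ, if_true, if_false,
    Bool.toNat_true, Bool.toNat_false, Bool.true_eq_false, Bool.false_eq_true, add_zero, zero_add]
  ring

theorem injective_two_mul_add_toNat :
    Function.Injective fun p : Fin n × Bool => 2 * (p.1 : ℕ) + p.2.toNat := by
  rintro ⟨i, a⟩ ⟨j, b⟩ h
  cases a <;> cases b <;> simp [Prod.ext_iff, Fin.ext_iff] at h ⊢ <;> omega

theorem IsStdSample.wassersteinDist_pairSum_le {Ω : Type*} [MeasurableSpace Ω] {P : Measure Ω}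
    [IsProbabilityMeasure P] {X : ℕ → Ω → ℝ} {m : NNReal} (hn : n ≠ 0)
    (h : IsStdSample P fun p : Fin n × Bool => X (2 * p.1 + p.2.toNat))
    (hm : ∀ k, ∫ ω, X k ω ^ 4 ∂P ≤ m) :
    wassersteinDist
        (P.map fun ω => 1 / √(n : ℝ) * ∑ k ∈ Finset.range n, X (2 * k) ω * X (2 * k + 1) ω)
        (gaussianReal 0 1) ≤
      ENNReal.ofReal (8 * (m / √(n : ℝ))) := by
  have hn_pos : (0 : ℝ) < n := Nat.cast_pos.2 (Nat.pos_of_ne_zero hn)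
  have hm_one : (1 : ℝ) ≤ m :=
    (h.one_le_integral_pow_four (⟨0, Nat.pos_of_ne_zero hn⟩, false)).trans (hm _)
  have h_col : ∀ p : Fin n × Bool, ∑ q, pairMatrix n q p ^ 2 = 1 / (4 * n : ℝ) := fun p => by
    simpa only [pairMatrix_symm _ p] using sum_pairMatrix_sq p
  have h_card : ∀ c : ℝ, ∑ _p : Fin n × Bool, c = 2 * n * c := fun c => by
    simp [mul_comm]
  have h_sum : ∑ p : Fin n × Bool, ∑ q, pairMatrix n p q ^ 2 = 1 / 2 := by
    simp only [sum_pairMatrix_sq, h_card]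
    field_simp
    norm_num
  have h_dist := h.wassersteinDist_quadSum_le (fun p => hm _) pairMatrix_symm pairMatrix_self h_sum
  simp only [quadSum_pairMatrix, sum_pairMatrix_mul, sum_pairMatrix_sq, h_col, ite_pow, ne_eq,
    OfNat.ofNat_ne_zero, not_false_eq_true, zero_pow, Finset.sum_ite_eq, Finset.mem_univ, if_true,
    h_card, show 2 * n * (1 / (4 * n : ℝ)) ^ 2 = 1 / (8 * n) by field_simp; norm_num] at h_dist
  have h_sqrt : ∀ x : ℝ, x ≤ 8 * m ^ 2 → √(x * (1 / (8 * n))) ≤ m / √(n : ℝ) := fun x hx => by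
    refine Real.sqrt_le_iff.2 ⟨by positivity, ?_⟩
    rw [div_pow, Real.sq_sqrt hn_pos.le, mul_one_div, div_le_div_iff₀ (by positivity) hn_pos]
    nlinarith
  have h_var := h_sqrt (m + 2) (by nlinarith)
  have h_rem := h_sqrt (3 * m + m ^ 2) (by nlinarith)
  rw [add_mul] at h_var
  refine h_dist.trans (ENNReal.ofReal_le_ofReal ?_)
  have : 0 ≤ m / √(n : ℝ) := by positivity
  linarith

theorem wassersteinDist_pairSum_le {Ω : Type*} [MeasurableSpace Ω] {P : Measure Ω}
    [IsProbabilityMeasure P] {X : ℕ → Ω → ℝ} (hmeas : ∀ k, AEMeasurable (X k) P)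
    (hindep : iIndepFun X P) (hmean : ∀ k, ∫ ω, X k ω ∂P = 0) (hvar : ∀ k, ∫ ω, X k ω ^ 2 ∂P = 1)
    {m : ℝ≥0∞} (hm : ∀ k, fourthMoment P (X k) ≤ m) (hn : n ≠ 0) :
    wassersteinDist
        (P.map fun ω => 1 / √(n : ℝ) * ∑ k ∈ Finset.range n, X (2 * k) ω * X (2 * k + 1) ω)
        (gaussianReal 0 1) ≤
      8 * m / ENNReal.ofReal √(n : ℝ) := by
  obtain rfl | hm_top := eq_or_ne m ∞
  · rw [ENNReal.mul_top (by norm_num), ENNReal.top_div_of_ne_top ENNReal.ofReal_ne_top]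
    exact le_top
  lift m to NNReal using hm_top
  have hn_pos : (0 : ℝ) < n := Nat.cast_pos.2 (Nat.pos_of_ne_zero hn)
  have h_sample : IsStdSample P fun p : Fin n × Bool => X (2 * p.1 + p.2.toNat) :=
    isStdSample_comp hmeas hindep hmean hvar
      (fun k => ((hm k).trans_lt ENNReal.coe_lt_top).ne) injective_two_mul_add_toNat
  have h_bound : ENNReal.ofReal (8 * (m / √(n : ℝ))) = 8 * m / ENNReal.ofReal √(n : ℝ) := by
    rw [ENNReal.ofReal_mul (by norm_num), ENNReal.ofReal_div_of_pos (Real.sqrt_pos.2 hn_pos),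
      ENNReal.ofReal_coe_nnreal, ENNReal.ofReal_ofNat, mul_div_assoc]
  exact (h_sample.wassersteinDist_pairSum_le hn
    fun k => integral_pow_four_le_of_fourthMoment_le (hm k)).trans_eq h_bound

end PairSum

theorem corollary7p2_general {Ω : Type*} [MeasurableSpace Ω] {P : Measure Ω}
    [IsProbabilityMeasure P] {X : ℕ → Ω → ℝ} (hmeas : ∀ k, AEMeasurable (X k) P)
    (hindep : iIndepFun X P) (hmean : ∀ k, ∫ ω, X k ω ∂P = 0) (hvar : ∀ k, ∫ ω, X k ω ^ 2 ∂P = 1)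
    {m : ℝ≥0∞} (hm : ∀ k, fourthMoment P (X k) ≤ m) :
    (∀ (n : ℕ) (A : Matrix (Fin n) (Fin n) ℝ), A.IsSymm → (∀ k, A k k = 0) →
      ∫ ω, quadForm A X ω ^ 2 ∂P = 1 →
      wassersteinDist (P.map (quadForm A X)) (gaussianReal 0 1) ≤
          2 * (m * ENNReal.ofReal (∑ l, (∑ k, A k l ^ 2) ^ 2)
              + 2 * ENNReal.ofReal (∑ l, ∑ p, (∑ k, A k l * A k p) ^ 2)) ^ (1 / 2 : ℝ)
          + 4 * ((3 * m + m ^ 2)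
              * ENNReal.ofReal (∑ k, (∑ l, A k l ^ 2) ^ 2)) ^ (1 / 2 : ℝ) ∧
      wassersteinDist (P.map (quadForm A X)) (gaussianReal 0 1) ≤
          ENNReal.ofReal (2 * √(n : ℝ) * maxRowSq A)
          * ((m + ENNReal.ofReal (2 / (n * maxRowSq A ^ 2)
                * ∑ l, ∑ p, (∑ k, A k l * A k p) ^ 2)) ^ (1 / 2 : ℝ)
            + 2 * (3 * m + m ^ 2) ^ (1 / 2 : ℝ))) ∧
    (∀ n : ℕ, 1 ≤ n →
      wassersteinDist
          (P.map (fun ω => 1 / √(n : ℝ) * ∑ k ∈ Finset.range n, X (2 * k) ω * X (2 * k + 1) ω))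
          (gaussianReal 0 1) ≤
        8 * m / ENNReal.ofReal √(n : ℝ)) := by
  refine ⟨fun n A hA hd hQ => ?_, fun n hn =>
    wassersteinDist_pairSum_le hmeas hindep hmean hvar hm (Nat.one_le_iff_ne_zero.1 hn)⟩
  have h_dist := wassersteinDist_quadForm_le hmeas hindep hmean hvar hm hA hd hQ
  have hA_ne : A ≠ 0 := ne_zero_of_integral_quadForm_sq (hQ.trans_ne one_ne_zero)
  obtain ⟨i, -⟩ := Function.ne_iff.1 hA_ne
  exact ⟨h_dist, h_dist.trans (wassersteinBound_le (Nat.cast_pos.2 i.pos) (maxRowSq_pos hA_ne)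
    ((sum_col_sq_sq_eq_sum_row_sq_sq hA).trans_le sum_row_sq_sq_le_maxRowSq)
    sum_row_sq_sq_le_maxRowSq)⟩

theorem corollary7p2 {Ω : Type*} [MeasurableSpace Ω] (P : Measure Ω) [IsProbabilityMeasure P]
    (X : ℕ → Ω → ℝ) (hmeas : ∀ k, Measurable (X k)) (hindep : iIndepFun X P)
    (hident : ∀ k, IdentDistrib (X k) (X 0) P P)
    (hmean : ∀ k, ∫ ω, X k ω ∂P = 0) (hvar : ∀ k, ∫ ω, X k ω ^ 2 ∂P = 1) :
    (∀ (n : ℕ) (A : Matrix (Fin n) (Fin n) ℝ), 2 ≤ n → A.IsSymm → (∀ k, A k k = 0) →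
      ∫ ω, quadForm A X ω ^ 2 ∂P = 1 →
      wassersteinDist (P.map (quadForm A X)) (gaussianReal 0 1) ≤
          2 * (fourthMoment P (X 0) * ENNReal.ofReal (∑ l, (∑ k, A k l ^ 2) ^ 2)
              + 2 * ENNReal.ofReal (∑ l, ∑ p, (∑ k, A k l * A k p) ^ 2)) ^ (1 / 2 : ℝ)
          + 4 * ((3 * fourthMoment P (X 0) + fourthMoment P (X 0) ^ 2)
              * ENNReal.ofReal (∑ k, (∑ l, A k l ^ 2) ^ 2)) ^ (1 / 2 : ℝ) ∧
      wassersteinDist (P.map (quadForm A X)) (gaussianReal 0 1) ≤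
          ENNReal.ofReal (2 * √(n : ℝ) * maxRowSq A)
          * ((fourthMoment P (X 0) + ENNReal.ofReal (2 / (n * maxRowSq A ^ 2)
                * ∑ l, ∑ p, (∑ k, A k l * A k p) ^ 2)) ^ (1 / 2 : ℝ)
            + 2 * (3 * fourthMoment P (X 0) + fourthMoment P (X 0) ^ 2) ^ (1 / 2 : ℝ))) ∧
    (∀ n : ℕ, 1 ≤ n →
      wassersteinDist
          (P.map (fun ω => 1 / √(n : ℝ) * ∑ k ∈ Finset.range n, X (2 * k) ω * X (2 * k + 1) ω))
          (gaussianReal 0 1) ≤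
        8 * fourthMoment P (X 0) / ENNReal.ofReal √(n : ℝ)) :=
  have h := corollary7p2_general (fun k => (hmeas k).aemeasurable) hindep hmean hvar
    fun k => (fourthMoment_congr (hident k)).le
  ⟨fun n A _ => h.1 n A, h.2⟩
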